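/- Call a measurable function $v:(0,\infty)\to[0,\infty]$ a weight if $0<\int_0^x v<\infty$ for all $x>0$, and let $\mathfrak M^+(0,\infty)$ be the set of all non-negative measurable functions on $(0,\infty)$. Use the conventions $0\cdot\infty=0$ and $1/0=\infty$, $1/\infty=0$. Let $0<q<\infty$, $0<r<\infty$, let $u,v,w$ be weights, and consider the inequality $$ \bigg(\int_0^\infty u(t)\,\sup_{s>t}\bigg(\int_t^s w\bigg)^{r/q}\bigg(\int_s^\infty h\bigg)^r dt\bigg)^{1/r}\le C\int_0^\infty h v\qquad\text{for all } h\in\mathfrak M^+(0,\infty). \tag{$*$} $$ Say that $(*)$ holds if it is satisfied with some finite constant $C$ independent of $h$, and let the best constant in $(*)$ be the infimum of all such $C$ ($\infty$ if there is none). (a) Let $r\ge 1$. Then $(*)$ holds if and only if $$ D_1:=\sup_{t>0}\bigg(\int_0^t u(x)\bigg(\int_x^t w\bigg)^{r/q}dx\bigg)^{1/r}\operatorname*{ess\,sup}_{t\le s<\infty} v(s)^{-1}<\infty $$ and $$ D_2:=\sup_{t>0}\bigg(\int_0^t u(x)\,dx\bigg)^{1/r}\operatorname*{ess\,sup}_{t\le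 s<\infty}\bigg(\int_t^s w\bigg)^{1/q}v(s)^{-1}<\infty . $$ Moreover, there is a constant $c\in(0,\infty)$ depending only on $q$ and $r$ such that the best constant $C$ in $(*)$ satisfies $c^{-1}(D_1+D_2)\le C\le c\,(D_1+D_2)$. (b) Let $r<1$ and $r'=r/(1-r)$. Then $(*)$ holds if and only if $$ E_1:=\bigg(\int_0^\infty\bigg(\int_0^t u\bigg)^{r'}u(t)\,\operatorname*{ess\,sup}_{t\le s<\infty}\bigg[\bigg(\int_t^s w\bigg)^{r'/q}v(s)^{-r'}\bigg]dt\bigg)^{1/r'}<\infty $$ and $$ E_2:=\bigg(\int_0^\infty\bigg(\int_0^t u(x)\bigg(\int_x^t w\bigg)^{r/q}dx\bigg)^{r'}u(t)\,\operatorname*{ess\,sup}_{t\le s<\infty}\bigg[\bigg(\int_t^s w\bigg)^{r/q}v(s)^{-r'}\bigg]dt\bigg)^{1/r'}<\infty . $$ Moreover, there is a constant $c\in(0,\infty)$ depending only on $q$ and $r$ such that the best constant $C$ in $(*)$ satisfies $c^{-1}(E_1+E_2)\le C\le c\,(E_1+E_2)$. -/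

import Mathlib

open Set MeasureTheory
open scoped ENNReal NNReal

namespace SupHardy

/-- Membership in `𝔐⁺(0,∞)`: `[0,∞]`-valued (Lebesgue) measurable functions on `(0,∞)`.
Functions are defined on `ℝ`, only their values on `(0,∞)` are ever used. -/
def MemMPlus (f : ℝ → ℝ≥0∞) : Prop :=
  AEMeasurable f (volume.restrict (Ioi (0 : ℝ)))

/-- A weight on `(0,∞)`: `v ∈ 𝔐⁺(0,∞)` with `0 < ∫_0^x v < ∞` for all `x > 0`. -/
structure IsWeight (v : ℝ → ℝ≥0∞) : Prop where
  memMPlus : MemMPlus v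
  pos : ∀ x : ℝ, 0 < x → 0 < ∫⁻ t in Ioc 0 x, v t
  lt_top : ∀ x : ℝ, 0 < x → ∫⁻ t in Ioc 0 x, v t < ∞

/-- The left-hand side
`(∫_0^∞ u(t) sup_{s > t} (∫_t^s w)^{r/q} (∫_s^∞ h)^r dt)^{1/r}`. -/
noncomputable def lhs (q r : ℝ) (u w h : ℝ → ℝ≥0∞) : ℝ≥0∞ :=
  (∫⁻ t in Ioi (0 : ℝ),
    u t * ⨆ s ∈ Ioi t, (∫⁻ y in Ioc t s, w y) ^ (r / q) * (∫⁻ y in Ioi s, h y) ^ r) ^ (1 / r)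

/-- The inequality `lhs ≤ C ∫_0^∞ h v` for all `h ∈ 𝔐⁺(0,∞)`, with the constant `C`. -/
def HoldsWith (q r : ℝ) (u v w : ℝ → ℝ≥0∞) (C : ℝ≥0) : Prop :=
  ∀ h : ℝ → ℝ≥0∞, MemMPlus h →
    lhs q r u w h ≤ (C : ℝ≥0∞) * ∫⁻ s in Ioi (0 : ℝ), h s * v s

/-- The inequality holds, that is, with some finite constant independent of `h`. -/
def Holds (q r : ℝ) (u v w : ℝ → ℝ≥0∞) : Prop :=
  ∃ C : ℝ≥0, HoldsWith q r u v w C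

/-- The best constant: the infimum of the admissible finite constants (`∞` if there is none). -/
noncomputable def bestConst (q r : ℝ) (u v w : ℝ → ℝ≥0∞) : ℝ≥0∞ :=
  ⨅ (C : ℝ≥0) (_ : HoldsWith q r u v w C), (C : ℝ≥0∞)

/-- `D₁ = sup_{t > 0} (∫_0^t u(x) (∫_x^t w)^{r/q} dx)^{1/r} · ess sup_{s ≥ t} v(s)⁻¹`. -/
noncomputable def D₁ (q r : ℝ) (u v w : ℝ → ℝ≥0∞) : ℝ≥0∞ :=
  ⨆ t ∈ Ioi (0 : ℝ),
    (∫⁻ x in Ioc 0 t, u x * (∫⁻ y in Ioc x t, w y) ^ (r / q)) ^ (1 / r) *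
      essSup (fun s => (v s)⁻¹) (volume.restrict (Ici t))

/-- `D₂ = sup_{t > 0} (∫_0^t u)^{1/r} · ess sup_{s ≥ t} (∫_t^s w)^{1/q} v(s)⁻¹`. -/
noncomputable def D₂ (q r : ℝ) (u v w : ℝ → ℝ≥0∞) : ℝ≥0∞ :=
  ⨆ t ∈ Ioi (0 : ℝ),
    (∫⁻ x in Ioc 0 t, u x) ^ (1 / r) *
      essSup (fun s => (∫⁻ y in Ioc t s, w y) ^ (1 / q) * (v s)⁻¹) (volume.restrict (Ici t))

/-- The exponent `r' = r / (1 - r)`, used for `0 < r < 1`. -/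
noncomputable def conj (r : ℝ) : ℝ := r / (1 - r)

/-- `E₁ = (∫_0^∞ (∫_0^t u)^{r'} u(t) · ess sup_{s ≥ t} (∫_t^s w)^{r'/q} v(s)^{-r'} dt)^{1/r'}`. -/
noncomputable def E₁ (q r : ℝ) (u v w : ℝ → ℝ≥0∞) : ℝ≥0∞ :=
  (∫⁻ t in Ioi (0 : ℝ),
    (∫⁻ x in Ioc 0 t, u x) ^ conj r * u t *
      essSup (fun s => (∫⁻ y in Ioc t s, w y) ^ (conj r / q) * v s ^ (-conj r))
        (volume.restrict (Ici t))) ^ (1 / conj r)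

/-- `E₂ = (∫_0^∞ (∫_0^t u(x) (∫_x^t w)^{r/q} dx)^{r'} u(t) ·
ess sup_{s ≥ t} (∫_t^s w)^{r/q} v(s)^{-r'} dt)^{1/r'}`. -/
noncomputable def E₂ (q r : ℝ) (u v w : ℝ → ℝ≥0∞) : ℝ≥0∞ :=
  (∫⁻ t in Ioi (0 : ℝ),
    (∫⁻ x in Ioc 0 t, u x * (∫⁻ y in Ioc x t, w y) ^ (r / q)) ^ conj r * u t *
      essSup (fun s => (∫⁻ y in Ioc t s, w y) ^ (r / q) * v s ^ (-conj r))
        (volume.restrict (Ici t))) ^ (1 / conj r)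

end SupHardy

/-!
Write `dμ = u dt`, `dω = w dt` on `(0,∞)`, `U(t) = μ(0,t]`, `k(x,t) = ω(x,t]^p` with `p = r / q`,
and `A(t) = ∫_0^t k(x,t) dμ(x)`. The kernel `k` decreases in `x`, increases in `t`, and satisfies
the quasi-triangle inequality `k(x,z) ≤ 2^p (k(x,y) + k(y,z))`. The `r`-th power of the left-hand
side of the inequality is `∫ sup_{s > t} k(t,s) H(s)^r dμ(t)` with `H(s) = ∫_s^∞ h`.

*Case `r ≥ 1`.* By Minkowski's inequality the best constant is at most `ess sup A^{1/r} / v`, and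
bumps approximating a point mass show that it is at least that. Since `A` is continuous and
increasing this essential supremum is `D₁` (`tailSup_mul_le_iSup`), and it dominates `D₂` because
`U(t) k(t,z) ≤ A(z)`.

*Case `r < 1`.* Put `a = r / (1 - r)` and `growth(x,z) = A(x) + U(x) k(x,z)`, which for `x ≤ z` is
comparable to `∫_0^x k(s,z) dμ(s)`. Up to constants `E₁^a + E₂^a` is the integral against `μ` of
`density(t) = ess sup_{z ≥ t} growth(t,z)^a k(t,z) v(z)^{-a}`.

For the upper bound (`measureHolds_of_fullDensity`), apply Hölder's inequality to
`k H^r = (k ψ^a)^{1-r} (k H / ψ)^r` with `ψ(s) = ess sup_{z ≥ s} A(z) / v(z)`. Since `ψ` decreases,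
`k(t,s) H(s) / ψ(s) ≤ ∫_t^∞ k(t,y) h(y) v(y) / A(y) dy`, whose integral against `μ` is at most
`∫ h v`. The other factor is bounded by `ess sup_{z ≥ t} k(t,z) A(z)^a v(z)^{-a}`; its integral is
controlled by that of `density` (`lintegral_fullDensity_le`), by splitting `A(z)^a` at `t` and
interchanging the integrals.

For the lower bound (`MeasureHolds.lintegral_density_le`), fix `T` and take a sequence decreasing
from `T` along which `U` and `A` both drop geometrically, but in each step one of them drops by its
prescribed factor only. Then the integral of `density` over one step is controlled by the two
quantities `peak(y) = ess sup_{z ≥ y} growth(y,z)^{1+a} v(z)^{-a}` at its end points. The geometric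
drops make `∫ k(t,x) dμ(t)` over two consecutive steps comparable to `growth(y,x)`
(`IsScale.growth_le`), so that testing with one bump for each step bounds the sum of the peaks.
-/

namespace SupHardy

open Filter Topology

/-! ### Kernels of atomless measures -/

/-- The distribution `f dt` of a weight `f`: an atomless measure carried by `(0,∞)` which gives
every interval `(0,t]` with `t > 0` a positive finite mass. -/
structure IsWeightMeasure (μ : Measure ℝ) : Prop where
  null : μ (Iic 0) = 0
  singleton : ∀ x, μ {x} = 0
  lt_top : ∀ t, μ (Iic t) < ∞
  pos : ∀ t, 0 < t → 0 < μ (Iic t)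

/-- If `μ` is finite on every `(-∞,t]`, the integral of a family of functions which is continuous in
the parameter at almost every point, vanishes to the right of the parameter and is locally bounded
depends continuously on the parameter. -/
lemma continuous_lintegral_of_le {μ : Measure ℝ} (hμ : ∀ t, μ (Iic t) < ∞)
    {f : ℝ → ℝ → ℝ≥0∞} (hm : ∀ t, Measurable (f t)) (hc : ∀ t, ∀ᵐ x ∂μ, ContinuousAt (f · x) t)
    {b : ℝ → ℝ≥0∞} (hb : ∀ T, b T ≠ ∞) (hle : ∀ T t x, t ≤ T → f t x ≤ b T)
    (hz : ∀ t x, t < x → f t x = 0) :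
    Continuous fun t => ∫⁻ x, f t x ∂μ := by
  rw [continuous_iff_continuousAt]
  intro t₀
  refine tendsto_lintegral_filter_of_dominated_convergence
    ((Iic (t₀ + 1)).indicator fun _ => b (t₀ + 1)) (Eventually.of_forall hm) ?_ ?_ (hc t₀)
  · filter_upwards [Iic_mem_nhds (show t₀ < t₀ + 1 by linarith)] with t ht
    refine Eventually.of_forall fun x => ?_
    by_cases hx : x ∈ Iic (t₀ + 1)
    · simpa [hx] using hle _ _ x ht
    · rw [hz t x (lt_of_le_of_lt ht (by simpa using hx))]
      exact zero_le
  · rw [lintegral_indicator measurableSet_Iic, setLIntegral_const]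
    exact ENNReal.mul_ne_top (hb _) (hμ _).ne

lemma continuous_measure_Iic {μ : Measure ℝ} (h1 : ∀ x, μ {x} = 0) (h2 : ∀ t, μ (Iic t) < ∞) :
    Continuous fun t => μ (Iic t) := by
  have := continuous_lintegral_of_le (μ := μ) h2 (f := fun t x => (Iic t).indicator 1 x)
    (fun t => measurable_const.indicator measurableSet_Iic) ?_ (b := fun _ => 1) (by simp)
    (fun T t x _ => indicator_le_self' (by simp) x |>.trans (by simp))
    (fun t x h => by simp [h])
  · simpa [lintegral_indicator_one measurableSet_Iic] using this
  · intro t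
    have : ∀ᵐ x ∂μ, x ≠ t := by simpa [ae_iff] using h1 t
    filter_upwards [this] with x hx
    rcases lt_or_gt_of_ne hx with h | h
    · refine (continuousAt_const (y := (1 : ℝ≥0∞))).congr ?_
      filter_upwards [Ioi_mem_nhds h] with s hs
      simp [le_of_lt (show x < s from hs)]
    · refine (continuousAt_const (y := (0 : ℝ≥0∞))).congr ?_
      filter_upwards [Iio_mem_nhds h] with s hs
      simp [show s < x from hs]

/-- The kernel `(∫_x^t dω)^p`. It vanishes for `t ≤ x` when `p > 0`. -/
noncomputable def kernel (ω : Measure ℝ) (p : ℝ) (x t : ℝ) : ℝ≥0∞ := ω (Ioc x t) ^ p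

/-- The function `A(t) = ∫_0^t (∫_x^t dω)^p dμ(x)`. -/
noncomputable def mass (μ ω : Measure ℝ) (p : ℝ) (t : ℝ) : ℝ≥0∞ := ∫⁻ x, kernel ω p x t ∂μ

/-- The function `A(x) + μ(0,x] (∫_x^z dω)^p`, comparable to
`∫_0^x (∫_s^z dω)^p dμ(s)` for `x ≤ z`. -/
noncomputable def growth (μ ω : Measure ℝ) (p : ℝ) (x z : ℝ) : ℝ≥0∞ :=
  mass μ ω p x + μ (Iic x) * kernel ω p x z

section kernel

variable {ω : Measure ℝ} {p : ℝ}

lemma kernel_mono (hp : 0 ≤ p) {x x' t t' : ℝ} (hx : x' ≤ x) (ht : t ≤ t') :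
    kernel ω p x t ≤ kernel ω p x' t' :=
  ENNReal.rpow_le_rpow (measure_mono (Ioc_subset_Ioc hx ht)) hp

lemma kernel_eq_zero (hp : 0 < p) {x t : ℝ} (h : t ≤ x) : kernel ω p x t = 0 := by
  simp [kernel, Ioc_eq_empty (not_lt.2 h), hp]

lemma kernel_ne_top (hω : IsWeightMeasure ω) (hp : 0 ≤ p) (x t : ℝ) : kernel ω p x t ≠ ∞ :=
  ENNReal.rpow_ne_top_of_nonneg hp
    (lt_of_le_of_lt (measure_mono Ioc_subset_Iic_self) (hω.lt_top t)).ne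

lemma add_rpow_le_two_rpow_mul (hp : 0 ≤ p) (a b : ℝ≥0∞) :
    (a + b) ^ p ≤ 2 ^ p * (a ^ p + b ^ p) := by
  have h : a + b ≤ 2 * max a b := by
    rw [two_mul]
    exact add_le_add (le_max_left _ _) (le_max_right _ _)
  refine (ENNReal.rpow_le_rpow h hp).trans ?_
  rw [ENNReal.mul_rpow_of_nonneg _ _ hp]
  gcongr
  rcases le_total a b with h | h
  · rw [max_eq_right h]; exact le_add_self
  · rw [max_eq_left h]; exact le_self_add

lemma kernel_le (hp : 0 ≤ p) (x y z : ℝ) :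
    kernel ω p x z ≤ 2 ^ p * (kernel ω p x y + kernel ω p y z) := by
  refine le_trans (ENNReal.rpow_le_rpow ?_ hp) (add_rpow_le_two_rpow_mul hp _ _)
  exact (measure_mono Ioc_subset_Ioc_union_Ioc).trans (measure_union_le _ _)

lemma measure_Ioc_eq (hω : IsWeightMeasure ω) (x t : ℝ) :
    ω (Ioc x t) = ω (Iic t) - ω (Iic x) := by
  rcases le_total x t with h | h
  · rw [← Iic_sdiff_Iic, measure_sdiff (Iic_subset_Iic.2 h) measurableSet_Iic.nullMeasurableSet
      (hω.lt_top x).ne]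
  · rw [Ioc_eq_empty (not_lt.2 h), measure_empty,
      tsub_eq_zero_of_le (measure_mono (Iic_subset_Iic.2 h))]

lemma continuous_kernel (hω : IsWeightMeasure ω) :
    Continuous fun z : ℝ × ℝ => kernel ω p z.1 z.2 := by
  have hc := continuous_measure_Iic hω.singleton hω.lt_top
  unfold kernel
  simp_rw [measure_Ioc_eq hω]
  refine (ENNReal.continuous_rpow_const).comp ?_
  rw [continuous_iff_continuousAt]
  intro z
  exact ENNReal.Tendsto.sub ((hc.comp continuous_snd).continuousAt)
    ((hc.comp continuous_fst).continuousAt) (Or.inl (hω.lt_top _).ne)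

lemma continuous_kernel_right (hω : IsWeightMeasure ω) (x : ℝ) :
    Continuous fun z => kernel ω p x z :=
  (continuous_kernel hω).comp (by fun_prop : Continuous fun z : ℝ => (x, z))

lemma continuous_kernel_left (hω : IsWeightMeasure ω) (z : ℝ) :
    Continuous fun x => kernel ω p x z :=
  (continuous_kernel hω).comp (by fun_prop : Continuous fun x : ℝ => (x, z))

lemma measurable_kernel (hω : IsWeightMeasure ω) :
    Measurable fun z : ℝ × ℝ => kernel ω p z.1 z.2 :=
  (continuous_kernel hω).measurable

end kernel

section mass

variable {μ ω : Measure ℝ} {p : ℝ}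

lemma IsWeightMeasure.ae_pos (hμ : IsWeightMeasure μ) : ∀ᵐ x ∂μ, 0 < x := by
  rw [ae_iff]
  simp only [not_lt]
  exact hμ.null

lemma mass_mono (hp : 0 ≤ p) : Monotone (mass μ ω p) :=
  fun _ _ h => lintegral_mono fun _ => kernel_mono hp le_rfl h

/-- The integral defining `mass` may be restricted to `(-∞,s]`, for any `s ≥ t`. -/
lemma setLIntegral_kernel_eq (hp : 0 < p) {s t : ℝ} (h : t ≤ s) :
    ∫⁻ x in Iic s, kernel ω p x t ∂μ = mass μ ω p t := by
  refine setLIntegral_eq_of_support_subset fun x hx => ?_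
  by_contra hx'
  exact hx (kernel_eq_zero hp (h.trans (le_of_lt (not_le.1 hx'))))

lemma mass_ne_top (hμ : IsWeightMeasure μ) (hω : IsWeightMeasure ω) (hp : 0 < p) (t : ℝ) :
    mass μ ω p t ≠ ∞ := by
  rw [← setLIntegral_kernel_eq hp le_rfl]
  refine ne_top_of_le_ne_top ?_ (setLIntegral_mono_ae (f := fun x => kernel ω p x t)
    (g := fun _ => kernel ω p 0 t) measurable_const.aemeasurable ?_)
  · rw [setLIntegral_const]
    exact ENNReal.mul_ne_top (kernel_ne_top hω hp.le _ _) (hμ.lt_top _).ne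
  · filter_upwards [hμ.ae_pos] with x hx _
    exact kernel_mono hp.le hx.le le_rfl

lemma continuous_mass (hμ : IsWeightMeasure μ) (hω : IsWeightMeasure ω) (hp : 0 < p) :
    Continuous (mass μ ω p) := by
  refine continuous_lintegral_of_le (f := fun t x => kernel ω p x t) hμ.lt_top
    (fun t => (continuous_kernel_left hω t).measurable)
    (fun t => Eventually.of_forall fun x => (continuous_kernel_right hω x).continuousAt)
    (b := fun T => ω (Iic T) ^ p)
    (fun T => ENNReal.rpow_ne_top_of_nonneg hp.le (hω.lt_top T).ne)
    (fun T t x h => ENNReal.rpow_le_rpow (measure_mono (Ioc_subset_Iic_self.trans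
      (Iic_subset_Iic.2 h))) hp.le)
    (fun t x h => kernel_eq_zero hp h.le)

lemma mass_zero (hμ : IsWeightMeasure μ) (hp : 0 < p) : mass μ ω p 0 = 0 := by
  rw [← setLIntegral_kernel_eq hp le_rfl, Measure.restrict_eq_zero.2 hμ.null, lintegral_zero_measure]

/-- Bound of the partial integral of the kernel from below, by its smallest value on `(0,x]`. -/
lemma measure_mul_kernel_le (hp : 0 ≤ p) (x z : ℝ) :
    μ (Iic x) * kernel ω p x z ≤ ∫⁻ s in Iic x, kernel ω p s z ∂μ := by
  rw [mul_comm, ← setLIntegral_const]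
  exact setLIntegral_mono' measurableSet_Iic fun s hs => kernel_mono hp hs le_rfl

lemma mass_pos (hμ : IsWeightMeasure μ) (hω : IsWeightMeasure ω) (hp : 0 < p) {t : ℝ}
    (ht : 0 < t) : 0 < mass μ ω p t := by
  have hc := continuous_measure_Iic hω.singleton hω.lt_top
  have h0 : ∀ᶠ x in 𝓝[>] (0 : ℝ), ω (Iic x) < ω (Iic t) :=
    (hc.tendsto 0).eventually_lt_const (by rw [hω.null]; exact hω.pos t ht)
      |>.filter_mono nhdsWithin_le_nhds
  obtain ⟨x, hx, hx0⟩ := (h0.and self_mem_nhdsWithin).exists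
  have hx0 : 0 < x := hx0
  have hk : 0 < kernel ω p x t := by
    rw [kernel, measure_Ioc_eq hω]
    exact ENNReal.rpow_pos (tsub_pos_of_lt hx)
      (ne_top_of_le_ne_top (hω.lt_top t).ne tsub_le_self)
  refine lt_of_lt_of_le (ENNReal.mul_pos (hμ.pos x hx0).ne' hk.ne') ?_
  exact (measure_mul_kernel_le hp.le x t).trans (setLIntegral_le_lintegral _ _)

lemma measure_mul_kernel_le_mass (hp : 0 ≤ p) (x z : ℝ) :
    μ (Iic x) * kernel ω p x z ≤ mass μ ω p z :=
  (measure_mul_kernel_le hp x z).trans (setLIntegral_le_lintegral _ _)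

/-- One half of the comparison of `growth` with the partial integrals of the kernel. -/
lemma setLIntegral_kernel_le_growth (hω : IsWeightMeasure ω) (hp : 0 < p) (x z : ℝ) :
    ∫⁻ s in Iic x, kernel ω p s z ∂μ ≤ 2 ^ p * growth μ ω p x z := by
  calc ∫⁻ s in Iic x, kernel ω p s z ∂μ
      ≤ ∫⁻ s in Iic x, 2 ^ p * (kernel ω p s x + kernel ω p x z) ∂μ :=
        lintegral_mono fun s => kernel_le hp.le s x z
    _ = 2 ^ p * growth μ ω p x z := by
        have hm := (continuous_kernel_left (p := p) hω x).measurable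
        rw [lintegral_const_mul _ (hm.add_const _), lintegral_add_left hm, setLIntegral_const,
          setLIntegral_kernel_eq hp le_rfl, growth, mul_comm (μ _)]

/-- The other half of the comparison of `growth` with the partial integrals of the kernel. -/
lemma growth_le_setLIntegral_kernel (hp : 0 < p) {x z : ℝ} (h : x ≤ z) :
    growth μ ω p x z ≤ 2 * ∫⁻ s in Iic x, kernel ω p s z ∂μ := by
  rw [two_mul, growth]
  refine add_le_add ?_ (measure_mul_kernel_le hp.le x z)
  rw [← setLIntegral_kernel_eq hp le_rfl]
  exact lintegral_mono fun s => kernel_mono hp.le le_rfl h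

lemma growth_le_mass (hp : 0 < p) {x z : ℝ} (h : x ≤ z) :
    growth μ ω p x z ≤ 2 * mass μ ω p z :=
  (growth_le_setLIntegral_kernel hp h).trans (by gcongr; exact setLIntegral_le_lintegral _ _)

lemma mass_le_growth_left (x z : ℝ) : mass μ ω p x ≤ growth μ ω p x z := le_self_add

lemma measure_mul_kernel_le_growth (x z : ℝ) :
    μ (Iic x) * kernel ω p x z ≤ growth μ ω p x z := le_add_self

lemma growth_ne_top (hμ : IsWeightMeasure μ) (hω : IsWeightMeasure ω) (hp : 0 < p) (x z : ℝ) :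
    growth μ ω p x z ≠ ∞ :=
  ENNReal.add_ne_top.2 ⟨mass_ne_top hμ hω hp x,
    ENNReal.mul_ne_top (hμ.lt_top x).ne (kernel_ne_top hω hp.le x z)⟩

lemma growth_pos (hμ : IsWeightMeasure μ) (hω : IsWeightMeasure ω) (hp : 0 < p) {x : ℝ}
    (hx : 0 < x) (z : ℝ) : 0 < growth μ ω p x z :=
  (mass_pos hμ hω hp hx).trans_le (mass_le_growth_left x z)

lemma continuous_growth_right (hμ : IsWeightMeasure μ) (hω : IsWeightMeasure ω) (x : ℝ) :
    Continuous fun z => growth μ ω p x z :=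
  continuous_const.add
    (ENNReal.continuous_const_mul (hμ.lt_top x).ne |>.comp (continuous_kernel_right hω x))

lemma measurable_growth (hμ : IsWeightMeasure μ) (hω : IsWeightMeasure ω) (hp : 0 < p) :
    Measurable fun z : ℝ × ℝ => growth μ ω p z.1 z.2 :=
  ((continuous_mass hμ hω hp).measurable.comp measurable_fst).add
    (((continuous_measure_Iic hμ.singleton hμ.lt_top).measurable.comp measurable_fst).mul
      (measurable_kernel hω))

end mass

/-! ### Essential suprema over tails -/

/-- The essential supremum of `f` over `[t,∞)`. -/
noncomputable def tailSup (f : ℝ → ℝ≥0∞) (t : ℝ) : ℝ≥0∞ := essSup f (volume.restrict (Ici t))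

section tailSup

variable {f g : ℝ → ℝ≥0∞} {t : ℝ}

lemma tailSup_le_iff {c : ℝ≥0∞} : tailSup f t ≤ c ↔ ∀ᵐ z, t ≤ z → f z ≤ c := by
  have h : (∀ᵐ z, t ≤ z → f z ≤ c) ↔ ∀ᵐ z ∂(volume.restrict (Ici t)), f z ≤ c :=
    (ae_restrict_iff' measurableSet_Ici).symm
  rw [h]
  exact ⟨fun hc => (ENNReal.ae_le_essSup f).mono fun z hz => hz.trans hc,
    fun hc => essSup_le_of_ae_le c hc⟩

lemma ae_le_tailSup (f : ℝ → ℝ≥0∞) (t : ℝ) : ∀ᵐ z, t ≤ z → f z ≤ tailSup f t :=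
  tailSup_le_iff.1 le_rfl

lemma tailSup_mono (h : ∀ z, t ≤ z → f z ≤ g z) : tailSup f t ≤ tailSup g t :=
  tailSup_le_iff.2 <| (ae_le_tailSup g t).mono fun z hz htz => (h z htz).trans (hz htz)

lemma tailSup_antitone (f : ℝ → ℝ≥0∞) : Antitone (tailSup f) := fun _ _ h =>
  tailSup_le_iff.2 <| (ae_le_tailSup f _).mono fun _ hz htz => hz (h.trans htz)

lemma const_mul_tailSup (c : ℝ≥0∞) (f : ℝ → ℝ≥0∞) (t : ℝ) :
    c * tailSup f t = tailSup (fun z => c * f z) t :=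
  ENNReal.essSup_const_mul.symm

lemma tailSup_add_le (f g : ℝ → ℝ≥0∞) (t : ℝ) :
    tailSup (fun z => f z + g z) t ≤ tailSup f t + tailSup g t :=
  ENNReal.essSup_add_le f g

/-- Multiplication by a continuous `g` inside an essential supremum: the supremum of `g z * f z` is
attained, in the limit, by moving `g` to the left end of a shorter tail. For almost every `z` the
value `f z` is bounded by the tail supremum from every rational `x < z`, and `x` may be chosen so
close to `z` that `g x` is close to `g z`. -/
lemma tailSup_mul_le_iSup (hg : Continuous g) (f : ℝ → ℝ≥0∞) (t : ℝ) :
    tailSup (fun z => g z * f z) t ≤ ⨆ x ∈ Ioi t, g x * tailSup f x := by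
  have h : ∀ᵐ z : ℝ, ∀ x : ℚ, (x : ℝ) ≤ z → f z ≤ tailSup f x :=
    ae_all_iff.2 fun x => ae_le_tailSup f x
  refine tailSup_le_iff.2 ?_
  filter_upwards [h, Measure.ae_ne volume t] with z hz hzt htz
  have htz : t < z := lt_of_le_of_ne htz hzt.symm
  by_contra! hlt
  have hgz : g z ≠ 0 := by
    rintro h0
    simp [h0] at hlt
  have hc : ContinuousAt (fun x => g x * f z) z :=
    ENNReal.Tendsto.mul_const hg.continuousAt (Or.inl hgz)
  have hev : ∀ᶠ x in 𝓝[<] z, (⨆ x ∈ Ioi t, g x * tailSup f x) < g x * f z :=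
    (hc.eventually_const_lt hlt).filter_mono nhdsWithin_le_nhds
  obtain ⟨l, hl, hsub⟩ := mem_nhdsLT_iff_exists_Ioo_subset.1 hev
  obtain ⟨x, hx1, hx2⟩ := exists_rat_btwn (max_lt (show l < z from hl) htz)
  have h1 := hsub ⟨(le_max_left l t).trans_lt hx1, hx2⟩
  have h2 : g x * f z ≤ ⨆ x ∈ Ioi t, g x * tailSup f x :=
    le_trans (by gcongr; exact hz x hx2.le)
      (le_iSup₂_of_le (x : ℝ) ((le_max_right l t).trans_lt hx1) le_rfl)
  exact absurd (h1.trans_le h2) (lt_irrefl _)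

/-- The tail supremum of a jointly measurable function is a measurable function of the parameter,
since it is at most `c` exactly if the sections of `{c < f}` are null. -/
lemma measurable_tailSup {f : ℝ × ℝ → ℝ≥0∞} (hf : Measurable f) :
    Measurable fun x => tailSup (fun z => f (x, z)) x := by
  refine measurable_of_Iic fun c => ?_
  have hs : MeasurableSet {y : ℝ × ℝ | y.1 ≤ y.2 ∧ c < f y} :=
    (measurableSet_le measurable_fst measurable_snd).inter (measurableSet_lt measurable_const hf)
  have : (fun x => tailSup (fun z => f (x, z)) x) ⁻¹' Iic c =
      (fun x => volume (Prod.mk x ⁻¹' {y : ℝ × ℝ | y.1 ≤ y.2 ∧ c < f y})) ⁻¹' {0} := by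
    ext x
    rw [mem_preimage, mem_Iic, tailSup_le_iff, ae_iff]
    simp only [Classical.not_imp, not_le, mem_preimage, mem_singleton_iff]
    rfl
  rw [this]
  exact measurable_measure_prodMk_left hs (measurableSet_singleton 0)

end tailSup

/-! ### Test functions -/

/-- The `r`-th power of the left-hand side of the inequality, written for the measures `dμ = u dt`
and `dω = w dt`. -/
noncomputable def supIntegral (μ ω : Measure ℝ) (p r : ℝ) (h : ℝ → ℝ≥0∞) : ℝ≥0∞ :=
  ∫⁻ t, ⨆ s ∈ Ioi t, kernel ω p t s * (∫⁻ y in Ioi s, h y) ^ r ∂μ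

/-- The inequality with constant `M`, raised to the power `r` and written for measures. -/
def MeasureHolds (μ ω : Measure ℝ) (p r : ℝ) (v : ℝ → ℝ≥0∞) (M : ℝ≥0∞) : Prop :=
  ∀ h : ℝ → ℝ≥0∞, Measurable h →
    supIntegral μ ω p r h ≤ (M * ∫⁻ y in Ioi (0 : ℝ), h y * v y) ^ r

section testFunctions

variable {μ ω : Measure ℝ} {p r : ℝ} {v : ℝ → ℝ≥0∞} {M : ℝ≥0∞}

/-- An approximation of a point mass: a function of integral one living to the right of `x`, at
points where `v ≤ b`. -/
lemma exists_bump (hv : Measurable v) {x : ℝ} {b : ℝ≥0∞}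
    (hb : volume {z | x < z ∧ v z ≤ b} ≠ 0) :
    ∃ h : ℝ → ℝ≥0∞, Measurable h ∧ (∀ s ≤ x, ∫⁻ y in Ioi s, h y = 1) ∧
      ∫⁻ y in Ioi (0 : ℝ), h y * v y ≤ b := by
  have hS : MeasurableSet {z | x < z ∧ v z ≤ b} :=
    (measurableSet_lt measurable_const measurable_id).inter (measurableSet_le hv measurable_const)
  obtain ⟨S, hSm, hsub, h0, hfin⟩ :=
    Measure.exists_subset_measure_lt_top hS (pos_iff_ne_zero.2 hb)
  refine ⟨S.indicator fun _ => (volume S)⁻¹, measurable_const.indicator hSm, fun s hs => ?_, ?_⟩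
  · rw [setLIntegral_indicator hSm, setLIntegral_const,
      inter_eq_left.2 (show S ⊆ Ioi s from fun z hz => hs.trans_lt (hsub hz).1)]
    exact ENNReal.inv_mul_cancel h0.ne' hfin.ne
  · calc ∫⁻ y in Ioi (0 : ℝ), S.indicator (fun _ => (volume S)⁻¹) y * v y
        ≤ ∫⁻ y, S.indicator (fun _ => (volume S)⁻¹ * b) y := by
          refine (setLIntegral_le_lintegral _ _).trans (lintegral_mono fun y => ?_)
          by_cases hy : y ∈ S
          · simp only [indicator_of_mem hy]
            gcongr
            exact (hsub hy).2
          · simp [hy]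
      _ = b := by
          rw [lintegral_indicator hSm, setLIntegral_const, mul_right_comm,
            ENNReal.inv_mul_cancel h0.ne' hfin.ne, one_mul]

/-- If `l < c · ess sup_{z ≥ x} v(z)^{-a}`, then `v` is small on a non-null set to the right of
`x`, in a quantitative form. -/
lemma exists_level {a : ℝ} (ha : 0 < a) {c l : ℝ≥0∞} {x : ℝ} (hc : c ≠ 0) (hc' : c ≠ ∞)
    (h : l < c * tailSup (fun z => v z ^ (-a)) x) :
    ∃ b : ℝ≥0∞, b ≠ 0 ∧ b ≠ ∞ ∧ volume {z | x < z ∧ v z ≤ b} ≠ 0 ∧ l ≤ c * b ^ (-a) := by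
  obtain ⟨l', hl, hl'⟩ := exists_between h
  have hl0 : l' ≠ 0 := (zero_le.trans_lt hl).ne'
  have hlt : l' ≠ ∞ := hl'.ne_top
  have hq0 : c / l' ≠ 0 := ENNReal.div_ne_zero.2 ⟨hc, hlt⟩
  have hqt : c / l' ≠ ∞ := ENNReal.div_ne_top hc' hl0
  refine ⟨(c / l') ^ (1 / a), ?_, ?_, ?_, ?_⟩
  · exact (ENNReal.rpow_pos (pos_iff_ne_zero.2 hq0) hqt).ne'
  · exact ENNReal.rpow_ne_top_of_nonneg (by positivity) hqt
  · intro h0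
    rw [const_mul_tailSup] at hl'
    refine hl'.not_ge (tailSup_le_iff.2 ?_)
    have h0' : ∀ᵐ z, ¬ (x < z ∧ v z ≤ (c / l') ^ (1 / a)) := by
      rw [ae_iff]; simpa using h0
    filter_upwards [h0', Measure.ae_ne volume x] with z hz hzx hxz
    by_contra! hlt'
    refine hz ⟨lt_of_le_of_ne hxz hzx.symm, ?_⟩
    have h1 : l' * v z ^ a ≤ c := by
      refine ENNReal.mul_le_of_le_div ?_
      rw [ENNReal.rpow_neg, ← div_eq_mul_inv] at hlt'
      exact hlt'.le
    have h2 : v z ^ a ≤ c / l' := by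
      rw [ENNReal.le_div_iff_mul_le (Or.inl hl0) (Or.inl hlt), mul_comm]; exact h1
    calc v z = (v z ^ a) ^ (1 / a) := by
          rw [← ENNReal.rpow_mul, mul_one_div_cancel ha.ne', ENNReal.rpow_one]
      _ ≤ _ := ENNReal.rpow_le_rpow h2 (by positivity)
  · rw [← ENNReal.rpow_mul, show 1 / a * -a = -1 by field_simp, ENNReal.rpow_neg_one,
      ENNReal.inv_div (Or.inl hlt) (Or.inl hl0), ENNReal.mul_div_cancel hc hc']
    exact hl.le

/-- Superposition of bumps. -/
lemma exists_sum_bump (hv : Measurable v) (F : Finset ℕ) (x : ℕ → ℝ) (b c : ℕ → ℝ≥0∞)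
    (hb : ∀ i ∈ F, volume {z | x i < z ∧ v z ≤ b i} ≠ 0) :
    ∃ h : ℝ → ℝ≥0∞, Measurable h ∧ (∀ i ∈ F, c i ≤ ∫⁻ y in Ioi (x i), h y) ∧
      ∫⁻ y in Ioi (0 : ℝ), h y * v y ≤ ∑ i ∈ F, c i * b i := by
  choose! g hgm hg1 hgv using fun i (hi : i ∈ F) => exists_bump hv (hb i hi)
  have hm : ∀ i ∈ F, Measurable fun y => c i * g i y := fun i hi => (hgm i hi).const_mul _
  refine ⟨fun y => ∑ i ∈ F, c i * g i y, Finset.measurable_fun_sum _ hm, fun i hi => ?_, ?_⟩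
  · calc c i = ∫⁻ y in Ioi (x i), c i * g i y := by
          rw [lintegral_const_mul _ (hgm i hi), hg1 i hi _ le_rfl, mul_one]
      _ ≤ _ := lintegral_mono fun y =>
          Finset.single_le_sum (f := fun i => c i * g i y) (fun _ _ => zero_le) hi
  · simp_rw [Finset.sum_mul]
    rw [lintegral_finsetSum' _ fun i hi =>
      show AEMeasurable (fun y => c i * g i y * v y) _ from ((hm i hi).mul hv).aemeasurable]
    refine Finset.sum_le_sum fun i hi => ?_
    simp_rw [mul_assoc]
    rw [lintegral_const_mul _ (show Measurable fun y => g i y * v y from (hgm i hi).mul hv)]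
    gcongr
    exact hgv i hi

/-- Evaluating the supremum at `s = x i` on each of a disjoint family of sets `Q i` which lie to
the left of `x i`. -/
lemma sum_setLIntegral_le_supIntegral (F : Finset ℕ) (x : ℕ → ℝ)
    (Q : ℕ → Set ℝ) (hQm : ∀ i, MeasurableSet (Q i)) (hQd : Pairwise (Function.onFun Disjoint Q))
    (hQx : ∀ i ∈ F, ∀ t ∈ Q i, t < x i) (h : ℝ → ℝ≥0∞) :
    ∑ i ∈ F, ∫⁻ t in Q i, kernel ω p t (x i) * (∫⁻ y in Ioi (x i), h y) ^ r ∂μ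
      ≤ supIntegral μ ω p r h := by
  calc _ ≤ ∑ i ∈ F, ∫⁻ t in Q i,
        ⨆ s ∈ Ioi t, kernel ω p t s * (∫⁻ y in Ioi s, h y) ^ r ∂μ := by
        refine Finset.sum_le_sum fun i hi => setLIntegral_mono' (hQm i) fun t ht => ?_
        exact le_iSup₂_of_le (x i) (hQx i hi t ht) le_rfl
    _ = ∫⁻ t in ⋃ i ∈ F, Q i,
        ⨆ s ∈ Ioi t, kernel ω p t s * (∫⁻ y in Ioi s, h y) ^ r ∂μ :=
        (lintegral_biUnion_finset (fun i _ j _ hij => hQd hij) (fun i _ => hQm i) _).symm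
    _ ≤ _ := setLIntegral_le_lintegral _ _

/-- The single-bump test. -/
lemma MeasureHolds.mass_rpow_mul_tailSup_le (hM : MeasureHolds μ ω p r v M) (hr : 0 < r)
    (hμ : IsWeightMeasure μ) (hω : IsWeightMeasure ω) (hp : 0 < p) (hv : Measurable v) {t : ℝ}
    (ht : 0 < t) : mass μ ω p t ^ (1 / r) * tailSup (fun z => (v z)⁻¹) t ≤ M := by
  have hA0 := mass_pos hμ hω hp ht
  have hAt := mass_ne_top hμ hω hp t
  have hA0' := (ENNReal.rpow_pos hA0 hAt (p := 1 / r)).ne'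
  have hAt' := ENNReal.rpow_ne_top_of_nonneg (y := 1 / r) (by positivity) hAt
  refine le_of_forall_lt fun l hl => ?_
  obtain ⟨l', hll', hl'⟩ := exists_between hl
  refine hll'.trans_le ?_
  simp_rw [← ENNReal.rpow_neg_one] at hl'
  obtain ⟨b, hb0, hbt, hb, hlb⟩ := exists_level one_pos hA0' hAt' hl'
  obtain ⟨h, hm, h1, hhv⟩ := exists_bump hv hb
  have key : mass μ ω p t ≤ (M * b) ^ r := by
    calc mass μ ω p t = ∫⁻ x in Iic t, kernel ω p x t ∂μ := (setLIntegral_kernel_eq hp le_rfl).symm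
      _ ≤ ∫⁻ x, ⨆ s ∈ Ioi x, kernel ω p x s * (∫⁻ y in Ioi s, h y) ^ r ∂μ := by
          rw [setLIntegral_kernel_eq hp le_rfl]
          refine lintegral_mono fun x => ?_
          rcases lt_or_ge x t with hx | hx
          · refine le_iSup₂_of_le t hx ?_
            rw [h1 t le_rfl, ENNReal.one_rpow, mul_one]
          · rw [kernel_eq_zero hp hx]; exact zero_le
      _ ≤ (M * ∫⁻ y in Ioi (0 : ℝ), h y * v y) ^ r := hM h hm
      _ ≤ (M * b) ^ r := by gcongr
  have key' : mass μ ω p t ^ (1 / r) ≤ M * b := by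
    rw [one_div]
    exact (ENNReal.rpow_inv_le_iff hr).2 key
  calc l' ≤ mass μ ω p t ^ (1 / r) * b ^ (-1 : ℝ) := hlb
    _ ≤ M * b * b ^ (-1 : ℝ) := by gcongr
    _ = M := by
      rw [ENNReal.rpow_neg_one, mul_assoc, ENNReal.mul_inv_cancel hb0 hbt, mul_one]

end testFunctions

/-- To bound a finite sum it suffices to bound all strictly smaller ones. -/
lemma sum_le_of_forall_lt {F : Finset ℕ} {N : ℕ → ℝ≥0∞} {C : ℝ≥0∞} (hN : ∀ i ∈ F, N i ≠ 0)
    (h : ∀ l : ℕ → ℝ≥0∞, (∀ i ∈ F, l i < N i) → ∑ i ∈ F, l i ≤ C) : ∑ i ∈ F, N i ≤ C := by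
  choose! l hl hlt hlim using fun i (hi : i ∈ F) =>
    exists_seq_strictMono_tendsto' (pos_iff_ne_zero.2 (hN i hi))
  refine le_of_tendsto' (tendsto_finsetSum F hlim) fun k => ?_
  exact h (fun i => l i k) fun i hi => (hlt i hi k).2

/-- Absorbing a power smaller than one. -/
lemma le_rpow_of_le_mul_rpow {r a : ℝ} (h : (1 - r) * (1 + a) = 1) (ha : 0 ≤ a) (hr : 0 < r)
    {S X : ℝ≥0∞} (hS : S ≠ ∞) (hle : S ≤ X * S ^ r) : S ≤ X ^ (1 + a) := by
  rcases eq_or_ne S 0 with rfl | h0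
  · exact zero_le
  have hr1 : S ^ r ≠ 0 := (ENNReal.rpow_pos (pos_iff_ne_zero.2 h0) hS).ne'
  have hr2 : S ^ r ≠ ∞ := ENNReal.rpow_ne_top_of_nonneg hr.le hS
  have h1 : S ^ (1 - r) * S ^ r ≤ X * S ^ r := by
    rw [← ENNReal.rpow_add _ _ h0 hS, sub_add_cancel, ENNReal.rpow_one]
    exact hle
  have h2 : S ^ (1 - r) ≤ X := (ENNReal.mul_le_mul_iff_left hr1 hr2).1 h1
  calc S = (S ^ (1 - r)) ^ (1 + a) := by rw [← ENNReal.rpow_mul, h, ENNReal.rpow_one]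
    _ ≤ X ^ (1 + a) := ENNReal.rpow_le_rpow h2 (by linarith)

/-! ### Scales adapted to two increasing functions -/

section scale

variable {μ ω : Measure ℝ} {p : ℝ}

/-- The two-parameter step: a point `y' ≤ y` by which both `μ(0,·]` has dropped by the
factor `2` and `A` has dropped by the factor `R`. At `y'` one of the two drops is exact. -/
lemma exists_next_scale (hμ : IsWeightMeasure μ) (hω : IsWeightMeasure ω) (hp : 0 < p)
    {R : ℝ≥0∞} (hR : R ≠ ∞) {y : ℝ} (hy : 0 < y) :
    ∃ y', 0 < y' ∧ y' ≤ y ∧ 2 * μ (Iic y') ≤ μ (Iic y) ∧ R * mass μ ω p y' ≤ mass μ ω p y ∧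
      (μ (Iic y) ≤ 2 * μ (Iic y') ∨ mass μ ω p y ≤ R * mass μ ω p y') := by
  have hU0 := (hμ.pos y hy).ne'
  have hUt := (hμ.lt_top y).ne
  have hA0 := (mass_pos hμ hω hp hy).ne'
  have hAt := mass_ne_top hμ hω hp y
  set f : ℝ → ℝ≥0∞ := fun t => max (2 * μ (Iic t) / μ (Iic y)) (R * mass μ ω p t / mass μ ω p y)
    with hf
  have hc : Continuous f := by
    refine Continuous.max ?_ ?_
    · exact (ENNReal.continuous_div_const _ hU0).comp
        ((ENNReal.continuous_const_mul (by simp)).comp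
          (continuous_measure_Iic hμ.singleton hμ.lt_top))
    · exact (ENNReal.continuous_div_const _ hA0).comp
        ((ENNReal.continuous_const_mul hR).comp (continuous_mass hμ hω hp))
  have h0 : f 0 = 0 := by simp [hf, hμ.null, mass_zero hμ hp]
  have h1 : 1 ≤ f y := by
    refine le_trans ?_ (le_max_left _ _)
    rw [mul_div_assoc, ENNReal.div_self hU0 hUt]
    simp
  obtain ⟨y', ⟨hy0, hyy⟩, hfy⟩ := intermediate_value_Icc hy.le hc.continuousOn
    (show (1 : ℝ≥0∞) ∈ Icc (f 0) (f y) from ⟨by simp [h0], h1⟩)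
  refine ⟨y', lt_of_le_of_ne hy0 ?_, hyy, ?_, ?_, ?_⟩
  · rintro rfl
    simp [h0] at hfy
  · have := (le_max_left _ _).trans hfy.le
    simpa using (ENNReal.div_le_iff hU0 hUt).1 this
  · have := (le_max_right _ _).trans hfy.le
    simpa using (ENNReal.div_le_iff hA0 hAt).1 this
  · rcases max_choice (2 * μ (Iic y') / μ (Iic y)) (R * mass μ ω p y' / mass μ ω p y) with h | h
    · left
      have h2 := (h.symm.trans hfy).ge
      rw [ENNReal.le_div_iff_mul_le (Or.inl hU0) (Or.inl hUt), one_mul] at h2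
      exact h2
    · right
      have h2 := (h.symm.trans hfy).ge
      rw [ENNReal.le_div_iff_mul_le (Or.inl hA0) (Or.inl hAt), one_mul] at h2
      exact h2

/-- A sequence decreasing from `T` along which both `μ(0,·]` and `A` drop geometrically, while
between consecutive terms at least one of them varies by a bounded factor only. -/
structure IsScale (μ ω : Measure ℝ) (p : ℝ) (R : ℝ≥0∞) (T : ℝ) (y : ℕ → ℝ) : Prop where
  zero : y 0 = T
  pos : ∀ n, 0 < y n
  anti : ∀ n, y (n + 1) ≤ y n
  measure_drop : ∀ n, 2 * μ (Iic (y (n + 1))) ≤ μ (Iic (y n))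
  mass_drop : ∀ n, R * mass μ ω p (y (n + 1)) ≤ mass μ ω p (y n)
  sharp : ∀ n, μ (Iic (y n)) ≤ 2 * μ (Iic (y (n + 1))) ∨
    mass μ ω p (y n) ≤ R * mass μ ω p (y (n + 1))

lemma exists_isScale (hμ : IsWeightMeasure μ) (hω : IsWeightMeasure ω) (hp : 0 < p)
    {R : ℝ≥0∞} (hR : R ≠ ∞) {T : ℝ} (hT : 0 < T) : ∃ y, IsScale μ ω p R T y := by
  choose! g h1 h2 h3 h4 h5 using
    fun (y : ℝ) (hy : 0 < y) => exists_next_scale (p := p) hμ hω hp hR hy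
  have hpos : ∀ n, 0 < (g^[n]) T := by
    intro n
    induction n with
    | zero => exact hT
    | succ n ih => rw [Function.iterate_succ_apply']; exact h1 _ ih
  refine ⟨fun n => (g^[n]) T, rfl, hpos, ?_, ?_, ?_, ?_⟩ <;> intro n <;>
    simp only [Function.iterate_succ_apply']
  · exact h2 _ (hpos n)
  · exact h3 _ (hpos n)
  · exact h4 _ (hpos n)
  · exact h5 _ (hpos n)

variable {R : ℝ≥0∞} {T : ℝ} {y : ℕ → ℝ}

lemma IsScale.antitone (h : IsScale μ ω p R T y) : Antitone y := antitone_nat_of_succ_le h.anti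

lemma IsScale.pairwise_disjoint (h : IsScale μ ω p R T y) :
    Pairwise (Function.onFun Disjoint fun n => Ioc (y (n + 1)) (y n)) :=
  h.antitone.pairwise_disjoint_on_Ioc_succ

lemma IsScale.Ioc_subset (h : IsScale μ ω p R T y) (hμ : IsWeightMeasure μ) :
    Ioc 0 T ⊆ ⋃ n, Ioc (y (n + 1)) (y n) := by
  intro t ht
  have hgeom : ∀ n : ℕ, (2 : ℝ≥0∞) ^ n * μ (Iic (y n)) ≤ μ (Iic T) := by
    intro n
    induction n with
    | zero => simp [h.zero]
    | succ n ih =>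
      rw [pow_succ, mul_assoc]
      exact le_trans (by gcongr; exact h.measure_drop n) ih
  have hex : ∃ n, y n < t := by
    by_contra! hcon
    obtain ⟨n, hn⟩ := ENNReal.exists_nat_mul_gt (hμ.pos t ht.1).ne' (hμ.lt_top T).ne
    refine hn.not_ge (le_trans ?_ (hgeom n))
    gcongr
    · exact_mod_cast Nat.lt_two_pow_self.le
    · exact hcon n
  classical
  obtain ⟨k, hk⟩ : ∃ k, Nat.find hex = k + 1 := by
    refine Nat.exists_eq_succ_of_ne_zero fun h0 => ?_
    have := Nat.find_spec hex
    rw [h0, h.zero] at this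
    exact this.not_ge ht.2
  refine mem_iUnion.2 ⟨k, ?_, ?_⟩
  · rw [← hk]; exact Nat.find_spec hex
  · exact not_lt.1 (Nat.find_min hex (by omega))

/-- Two consecutive steps of a scale carry a fixed proportion of the whole mass: this is where the
factor `R ≥ 2^{p+1}` absorbs the constant of the quasi-triangle inequality of the kernel. -/
lemma IsScale.growth_le (h : IsScale μ ω p (2 ^ (p + 1)) T y) (hμ : IsWeightMeasure μ)
    (hω : IsWeightMeasure ω) (hp : 0 < p) (n : ℕ) {x : ℝ} (hx : y n ≤ x) :
    growth μ ω p (y n) x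
      ≤ (2 ^ (p + 1) + 4) * ∫⁻ t in Ioc (y (n + 2)) (y n), kernel ω p t x ∂μ := by
  set I := ∫⁻ t in Ioc (y (n + 2)) (y n), kernel ω p t x ∂μ with hI
  have h10 : y (n + 1) ≤ y n := h.anti n
  have h21 : y (n + 2) ≤ y (n + 1) := h.anti (n + 1)
  have h20 := h21.trans h10
  have split : ∀ {a b : ℝ}, a ≤ b → ∀ f : ℝ → ℝ≥0∞,
      ∫⁻ t in Iic b, f t ∂μ = ∫⁻ t in Iic a, f t ∂μ + ∫⁻ t in Ioc a b, f t ∂μ := by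
    intro a b hab f
    rw [← Iic_union_Ioc_eq_Iic hab, lintegral_union measurableSet_Ioc (Iic_disjoint_Ioc le_rfl)]
  have hdrop : ∀ {a b : ℝ}, a ≤ b → 2 * μ (Iic a) ≤ μ (Iic b) → μ (Iic a) ≤ μ (Ioc a b) := by
    intro a b hab hle
    rw [measure_Ioc_eq hμ]
    refine ENNReal.le_sub_of_add_le_left (hμ.lt_top a).ne ?_
    rwa [← two_mul]
  have hconst : ∀ {a b z : ℝ},
      μ (Ioc a b) * kernel ω p b z ≤ ∫⁻ t in Ioc a b, kernel ω p t z ∂μ := by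
    intro a b z
    rw [mul_comm, ← setLIntegral_const]
    exact setLIntegral_mono' measurableSet_Ioc fun s hs => kernel_mono hp.le hs.2 le_rfl
  -- the contribution of `(y (n + 2), y n]` to `A (y n)`
  have hnear : ∫⁻ t in Ioc (y (n + 2)) (y n), kernel ω p t (y n) ∂μ ≤ I :=
    lintegral_mono fun t => kernel_mono hp.le le_rfl hx
  -- the contribution of `(0, y (n + 2)]` to `A (y n)`
  have hfar : ∫⁻ t in Iic (y (n + 2)), kernel ω p t (y n) ∂μ
      ≤ 2 ^ p * (mass μ ω p (y (n + 1)) + I) := by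
    have hm := (continuous_kernel_left (p := p) hω (y (n + 1))).measurable
    calc _ ≤ ∫⁻ t in Iic (y (n + 2)),
          2 ^ p * (kernel ω p t (y (n + 1)) + kernel ω p (y (n + 1)) (y n)) ∂μ :=
          lintegral_mono fun t => kernel_le hp.le _ _ _
      _ = 2 ^ p * (∫⁻ t in Iic (y (n + 2)), kernel ω p t (y (n + 1)) ∂μ +
          μ (Iic (y (n + 2))) * kernel ω p (y (n + 1)) (y n)) := by
          rw [lintegral_const_mul _ (hm.add_const _), lintegral_add_left hm, setLIntegral_const,
            mul_comm (μ _)]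
      _ ≤ _ := by
          gcongr
          · exact setLIntegral_le_lintegral _ _
          · calc μ (Iic (y (n + 2))) * kernel ω p (y (n + 1)) (y n)
                ≤ μ (Ioc (y (n + 2)) (y (n + 1))) * kernel ω p (y (n + 1)) x := by
                  exact mul_le_mul' (hdrop h21 (h.measure_drop (n + 1)))
                    (kernel_mono hp.le le_rfl hx)
              _ ≤ ∫⁻ t in Ioc (y (n + 2)) (y (n + 1)), kernel ω p t x ∂μ := hconst
              _ ≤ I := lintegral_mono_set (Ioc_subset_Ioc_right h10)
  have hA : mass μ ω p (y n) ≤ (2 ^ (p + 1) + 2) * I := by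
    have hsum : mass μ ω p (y n) ≤ 2 ^ p * mass μ ω p (y (n + 1)) + (2 ^ p + 1) * I := by
      calc mass μ ω p (y n) = ∫⁻ t in Iic (y (n + 2)), kernel ω p t (y n) ∂μ +
            ∫⁻ t in Ioc (y (n + 2)) (y n), kernel ω p t (y n) ∂μ := by
            rw [← split h20, setLIntegral_kernel_eq hp le_rfl]
        _ ≤ 2 ^ p * (mass μ ω p (y (n + 1)) + I) + I := add_le_add hfar hnear
        _ = _ := by ring
    have h2p : (2 : ℝ≥0∞) ^ (p + 1) = 2 * 2 ^ p := by
      rw [ENNReal.rpow_add _ _ (by simp) (by simp), ENNReal.rpow_one, mul_comm]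
    have hdbl : mass μ ω p (y n) + mass μ ω p (y n)
        ≤ mass μ ω p (y n) + (2 ^ (p + 1) + 2) * I := by
      calc mass μ ω p (y n) + mass μ ω p (y n)
          ≤ (2 ^ p * mass μ ω p (y (n + 1)) + (2 ^ p + 1) * I) +
            (2 ^ p * mass μ ω p (y (n + 1)) + (2 ^ p + 1) * I) := add_le_add hsum hsum
        _ = 2 ^ (p + 1) * mass μ ω p (y (n + 1)) + (2 ^ (p + 1) + 2) * I := by rw [h2p]; ring
        _ ≤ _ := by gcongr; exact h.mass_drop n
    exact (ENNReal.add_le_add_iff_left (mass_ne_top hμ hω hp _)).1 hdbl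
  have hU : μ (Iic (y n)) * kernel ω p (y n) x ≤ 2 * I := by
    have h1 : μ (Iic (y n)) ≤ 2 * μ (Ioc (y (n + 2)) (y n)) := by
      have h2 : 2 * μ (Iic (y (n + 2))) ≤ μ (Iic (y n)) :=
        le_trans (by gcongr) (h.measure_drop n)
      have h3 : μ (Iic (y n)) = μ (Iic (y (n + 2))) + μ (Ioc (y (n + 2)) (y n)) := by
        rw [← measure_union (Iic_disjoint_Ioc le_rfl) measurableSet_Ioc, Iic_union_Ioc_eq_Iic h20]
      rw [h3, two_mul]
      exact add_le_add (hdrop h20 h2) le_rfl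
    calc μ (Iic (y n)) * kernel ω p (y n) x
        ≤ 2 * (μ (Ioc (y (n + 2)) (y n)) * kernel ω p (y n) x) := by rw [← mul_assoc]; gcongr
      _ ≤ 2 * I := by gcongr; exact hconst
  calc growth μ ω p (y n) x ≤ (2 ^ (p + 1) + 2) * I + 2 * I := add_le_add hA hU
    _ = _ := by ring

end scale

/-! ### The lower bound for exponents below one -/

/-- The integrand of `E₁` and `E₂` taken together, up to constants and without the factor `u`:
`ess sup_{z ≥ x} growth(x,z)^a (∫_x^z dω)^p v(z)^{-a}`. -/
noncomputable def density (μ ω : Measure ℝ) (p a : ℝ) (v : ℝ → ℝ≥0∞) (x : ℝ) : ℝ≥0∞ :=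
  tailSup (fun z => growth μ ω p x z ^ a * kernel ω p x z * v z ^ (-a)) x

/-- The contribution `ess sup_{z ≥ y} growth(y,z)^{1+a} v(z)^{-a}` of a single scale. -/
noncomputable def peak (μ ω : Measure ℝ) (p a : ℝ) (v : ℝ → ℝ≥0∞) (y : ℝ) : ℝ≥0∞ :=
  tailSup (fun z => growth μ ω p y z ^ (1 + a) * v z ^ (-a)) y

section

variable {μ ω : Measure ℝ} {p a r : ℝ} {v : ℝ → ℝ≥0∞}

lemma rpow_one_add {a : ℝ} (ha : 0 ≤ a) (b : ℝ≥0∞) : b ^ (1 + a) = b * b ^ a := by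
  rw [ENNReal.rpow_add_of_nonneg _ _ zero_le_one ha, ENNReal.rpow_one]

lemma mass_le (hω : IsWeightMeasure ω) (hp : 0 < p) {s t : ℝ} (h : s ≤ t) :
    mass μ ω p t ≤ 2 ^ p * (mass μ ω p s + μ (Iic t) * kernel ω p s t) := by
  have hm := (continuous_kernel_left (p := p) hω s).measurable
  calc mass μ ω p t = ∫⁻ x in Iic t, kernel ω p x t ∂μ := (setLIntegral_kernel_eq hp le_rfl).symm
    _ ≤ ∫⁻ x in Iic t, 2 ^ p * (kernel ω p x s + kernel ω p s t) ∂μ :=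
        lintegral_mono fun x => kernel_le hp.le x s t
    _ = 2 ^ p * (mass μ ω p s + μ (Iic t) * kernel ω p s t) := by
        rw [lintegral_const_mul _ (hm.add_const _), lintegral_add_left hm, setLIntegral_const,
          setLIntegral_kernel_eq hp h, mul_comm (μ _)]

lemma measure_mul_density_le (ha : 0 ≤ a) (x : ℝ) :
    μ (Iic x) * density μ ω p a v x ≤ peak μ ω p a v x := by
  rw [density, const_mul_tailSup]
  refine tailSup_mono fun z _ => ?_
  calc μ (Iic x) * (growth μ ω p x z ^ a * kernel ω p x z * v z ^ (-a))
      = (μ (Iic x) * kernel ω p x z) * growth μ ω p x z ^ a * v z ^ (-a) := by ring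
    _ ≤ _ := by
      rw [rpow_one_add ha]
      gcongr
      exact measure_mul_kernel_le_growth x z

/-- The density over an interval on which `μ(0,·]` varies by a factor at most `2`. -/
lemma setLIntegral_density_le_of_measure_le (hω : IsWeightMeasure ω) (hp : 0 < p) (ha : 0 ≤ a)
    {s y : ℝ} (h : μ (Iic y) ≤ 2 * μ (Iic s)) :
    ∫⁻ t in Ioc s y, density μ ω p a v t ∂μ
      ≤ 2 * (2 * 2 ^ p + 2) ^ a * peak μ ω p a v s := by
  have hg : ∀ t ∈ Ioc s y, ∀ z, t ≤ z →
      growth μ ω p t z ≤ (2 * 2 ^ p + 2) * growth μ ω p s z := by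
    intro t ht z hz
    have hUt : μ (Iic t) ≤ 2 * μ (Iic s) := (measure_mono (Iic_subset_Iic.2 ht.2)).trans h
    calc growth μ ω p t z
        ≤ 2 ^ p * (mass μ ω p s + μ (Iic t) * kernel ω p s t) + μ (Iic t) * kernel ω p t z :=
          add_le_add (mass_le hω hp ht.1.le) le_rfl
      _ ≤ 2 ^ p * (mass μ ω p s + 2 * μ (Iic s) * kernel ω p s z)
          + 2 * μ (Iic s) * kernel ω p s z := by
          gcongr 2 ^ p * (_ + ?_) + ?_
          · exact mul_le_mul' hUt (kernel_mono hp.le le_rfl hz)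
          · exact mul_le_mul' hUt (kernel_mono hp.le ht.1.le le_rfl)
      _ = 2 ^ p * mass μ ω p s + (2 * 2 ^ p + 2) * (μ (Iic s) * kernel ω p s z) := by ring
      _ ≤ (2 * 2 ^ p + 2) * mass μ ω p s + (2 * 2 ^ p + 2) * (μ (Iic s) * kernel ω p s z) := by
          gcongr
          rw [two_mul, add_assoc]
          exact le_self_add
      _ = _ := by rw [growth, mul_add]
  have hn : ∀ t ∈ Ioc s y, density μ ω p a v t ≤ (2 * 2 ^ p + 2) ^ a * density μ ω p a v s := by
    intro t ht
    calc density μ ω p a v t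
        ≤ tailSup (fun z => (2 * 2 ^ p + 2) ^ a *
            (growth μ ω p s z ^ a * kernel ω p s z * v z ^ (-a))) t := by
          refine tailSup_mono fun z hz => ?_
          rw [← mul_assoc, ← mul_assoc, ← ENNReal.mul_rpow_of_nonneg _ _ ha]
          gcongr
          · exact hg t ht z hz
          · exact kernel_mono hp.le ht.1.le le_rfl
      _ ≤ _ := by
          rw [← const_mul_tailSup]
          gcongr
          exact tailSup_antitone _ ht.1.le
  calc ∫⁻ t in Ioc s y, density μ ω p a v t ∂μ
      ≤ ∫⁻ t in Ioc s y, (2 * 2 ^ p + 2) ^ a * density μ ω p a v s ∂μ :=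
        setLIntegral_mono' measurableSet_Ioc hn
    _ = (2 * 2 ^ p + 2) ^ a * density μ ω p a v s * μ (Ioc s y) := setLIntegral_const _ _
    _ ≤ (2 * 2 ^ p + 2) ^ a * density μ ω p a v s * (2 * μ (Iic s)) := by
        gcongr
        exact (measure_mono Ioc_subset_Iic_self).trans h
    _ = 2 * (2 * 2 ^ p + 2) ^ a * (μ (Iic s) * density μ ω p a v s) := by ring
    _ ≤ _ := by gcongr; exact measure_mul_density_le ha s

/-- The density over an interval on which `A` varies by a factor at most `R`. -/
lemma setLIntegral_density_le_of_mass_le (hω : IsWeightMeasure ω) (hp : 0 < p) (ha : 0 ≤ a)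
    {R : ℝ≥0∞} {s y : ℝ} (h : mass μ ω p y ≤ R * mass μ ω p s) :
    ∫⁻ t in Ioc s y, density μ ω p a v t ∂μ
      ≤ 2 * (2 ^ p * (1 + 2 ^ p) ^ a) *
        (peak μ ω p a v y + R ^ (1 + a) * peak μ ω p a v s) := by
  set X := tailSup (fun z => growth μ ω p y z ^ (1 + a) * v z ^ (-a)) s with hX
  set α := tailSup (fun z => growth μ ω p y z ^ a * v z ^ (-a)) s with hα
  set β := tailSup (fun z => kernel ω p y z * (growth μ ω p y z ^ a * v z ^ (-a))) s with hβ
  have hXle : X ≤ peak μ ω p a v y + R ^ (1 + a) * peak μ ω p a v s := by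
    refine tailSup_le_iff.2 ?_
    filter_upwards [ae_le_tailSup (fun z => growth μ ω p y z ^ (1 + a) * v z ^ (-a)) y,
      ae_le_tailSup (fun z => growth μ ω p s z ^ (1 + a) * v z ^ (-a)) s] with z h1 h2 hz
    rcases le_or_gt y z with hyz | hyz
    · exact (h1 hyz).trans le_self_add
    · refine le_trans ?_ le_add_self
      have hg : growth μ ω p y z ≤ R * growth μ ω p s z := by
        rw [growth, kernel_eq_zero hp hyz.le, mul_zero, add_zero]
        exact h.trans (by gcongr; exact mass_le_growth_left s z)
      calc growth μ ω p y z ^ (1 + a) * v z ^ (-a)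
          ≤ (R * growth μ ω p s z) ^ (1 + a) * v z ^ (-a) := by gcongr
        _ = R ^ (1 + a) * (growth μ ω p s z ^ (1 + a) * v z ^ (-a)) := by
            rw [ENNReal.mul_rpow_of_nonneg _ _ (by positivity), mul_assoc]
        _ ≤ _ := by gcongr; exact h2 hz
  have hAα : mass μ ω p y * α ≤ X := by
    rw [hα, const_mul_tailSup]
    refine tailSup_mono fun z _ => ?_
    rw [rpow_one_add ha, ← mul_assoc]
    gcongr
    exact mass_le_growth_left y z
  have hUβ : μ (Iic y) * β ≤ X := by
    rw [hβ, const_mul_tailSup]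
    refine tailSup_mono fun z _ => ?_
    rw [rpow_one_add ha, ← mul_assoc, ← mul_assoc]
    gcongr
    exact measure_mul_kernel_le_growth y z
  have hg : ∀ t ∈ Ioc s y, ∀ z, growth μ ω p t z ≤ (1 + 2 ^ p) * growth μ ω p y z := by
    intro t ht z
    have hU : μ (Iic t) ≤ μ (Iic y) := measure_mono (Iic_subset_Iic.2 ht.2)
    have h1p : (1 : ℝ≥0∞) ≤ 1 + 2 ^ p := le_self_add
    have hAg : mass μ ω p t + 2 ^ p * (μ (Iic t) * kernel ω p t y)
        ≤ (1 + 2 ^ p) * mass μ ω p y := by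
      rw [add_mul, one_mul]
      exact add_le_add (mass_mono hp.le ht.2) (by gcongr; exact measure_mul_kernel_le_mass hp.le t y)
    calc growth μ ω p t z
        ≤ mass μ ω p t + μ (Iic t) * (2 ^ p * (kernel ω p t y + kernel ω p y z)) :=
          add_le_add le_rfl (by gcongr; exact kernel_le hp.le t y z)
      _ = (mass μ ω p t + 2 ^ p * (μ (Iic t) * kernel ω p t y))
          + 2 ^ p * (μ (Iic t) * kernel ω p y z) := by ring
      _ ≤ (1 + 2 ^ p) * mass μ ω p y + (1 + 2 ^ p) * (μ (Iic y) * kernel ω p y z) := by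
          refine add_le_add hAg ?_
          gcongr
          exact le_add_self
      _ = _ := by rw [growth, mul_add]
  have hn : ∀ t ∈ Ioc s y,
      density μ ω p a v t ≤ 2 ^ p * (1 + 2 ^ p) ^ a * (kernel ω p t y * α + β) := by
    intro t ht
    calc density μ ω p a v t
        ≤ tailSup (fun z => 2 ^ p * (1 + 2 ^ p) ^ a *
            (kernel ω p t y * (growth μ ω p y z ^ a * v z ^ (-a)) +
              kernel ω p y z * (growth μ ω p y z ^ a * v z ^ (-a)))) t := by
          refine tailSup_mono fun z _ => ?_
          calc growth μ ω p t z ^ a * kernel ω p t z * v z ^ (-a)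
              ≤ ((1 + 2 ^ p) * growth μ ω p y z) ^ a *
                (2 ^ p * (kernel ω p t y + kernel ω p y z)) * v z ^ (-a) := by
                gcongr
                · exact hg t ht z
                · exact kernel_le hp.le t y z
            _ = _ := by rw [ENNReal.mul_rpow_of_nonneg _ _ ha]; ring
      _ ≤ _ := by
          rw [← const_mul_tailSup]
          gcongr
          refine (tailSup_antitone _ ht.1.le).trans ((tailSup_add_le _ _ _).trans ?_)
          rw [← const_mul_tailSup]
  have hm : Measurable fun t => kernel ω p t y * α :=
    (continuous_kernel_left hω y).measurable.mul_const _
  calc ∫⁻ t in Ioc s y, density μ ω p a v t ∂μ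
      ≤ ∫⁻ t in Ioc s y, 2 ^ p * (1 + 2 ^ p) ^ a * (kernel ω p t y * α + β) ∂μ :=
        setLIntegral_mono' measurableSet_Ioc hn
    _ = 2 ^ p * (1 + 2 ^ p) ^ a *
        ((∫⁻ t in Ioc s y, kernel ω p t y ∂μ) * α + μ (Ioc s y) * β) := by
        rw [lintegral_const_mul _ (hm.add_const _), lintegral_add_left hm,
          lintegral_mul_const _ (continuous_kernel_left hω y).measurable, setLIntegral_const,
          mul_comm β]
    _ ≤ 2 ^ p * (1 + 2 ^ p) ^ a * (mass μ ω p y * α + μ (Iic y) * β) := by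
        gcongr
        · exact setLIntegral_le_lintegral _ _
        · exact Ioc_subset_Iic_self
    _ ≤ 2 ^ p * (1 + 2 ^ p) ^ a * (X + X) := by gcongr
    _ = 2 * (2 ^ p * (1 + 2 ^ p) ^ a) * X := by ring
    _ ≤ _ := by gcongr

/-- The peaks along a scale are summable, by testing the inequality with a superposition of
bumps, one to the right of a nearly optimal point for each peak. -/
lemma MeasureHolds.sum_peak_le {M : ℝ≥0∞} (hM : MeasureHolds μ ω p r v M) (hr : 0 < r)
    (hr1 : r < 1) (ha : a = r / (1 - r)) (hμ : IsWeightMeasure μ) (hω : IsWeightMeasure ω)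
    (hp : 0 < p) (hv : Measurable v) {T : ℝ} {y : ℕ → ℝ}
    (h : IsScale μ ω p (2 ^ (p + 1)) T y) (F : Finset ℕ) :
    ∑ i ∈ F, peak μ ω p a v (y i) ≤ (2 * (2 ^ (p + 1) + 4)) ^ (1 + a) * M ^ a := by
  have h1r : 0 < 1 - r := by linarith
  have ha0 : 0 < a := by rw [ha]; positivity
  have hra : (1 + a) * r = a := by rw [ha]; field_simp; ring
  have hra' : (1 - r) * (1 + a) = 1 := by rw [ha]; field_simp; ring
  have hD0 : ∀ i z, growth μ ω p (y i) z ≠ 0 := fun i z => (growth_pos hμ hω hp (h.pos i) z).ne'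
  have hDt : ∀ i z, growth μ ω p (y i) z ≠ ∞ := fun i z => growth_ne_top hμ hω hp _ z
  rw [← Finset.sum_filter_ne_zero]
  set G := F.filter fun i => peak μ ω p a v (y i) ≠ 0
  refine sum_le_of_forall_lt (fun i hi => (Finset.mem_filter.1 hi).2) fun l hl => ?_
  have hex : ∀ i ∈ G, ∃ x b, y i < x ∧ b ≠ 0 ∧ b ≠ ∞ ∧ volume {z | x < z ∧ v z ≤ b} ≠ 0 ∧
      l i ≤ growth μ ω p (y i) x ^ (1 + a) * b ^ (-a) := by
    intro i hi
    have h1 := (hl i hi).trans_le (tailSup_mul_le_iSup (ENNReal.continuous_rpow_const.comp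
      (continuous_growth_right hμ hω (y i))) (fun z => v z ^ (-a)) (y i))
    simp only [lt_iSup_iff] at h1
    obtain ⟨x, hx, h1⟩ := h1
    obtain ⟨b, hb⟩ := exists_level ha0
      (ENNReal.rpow_pos (pos_iff_ne_zero.2 (hD0 i x)) (hDt i x)).ne'
      (ENNReal.rpow_ne_top_of_nonneg (by positivity) (hDt i x)) h1
    exact ⟨x, b, hx, hb⟩
  choose! x b hxy hb0 hbt hb hlb using hex
  -- the masses of the bumps are the extremal ones in the duality of `ℓ^{1/r}`
  set D : ℕ → ℝ≥0∞ := fun i => growth μ ω p (y i) (x i) with hD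
  set c : ℕ → ℝ≥0∞ := fun i => (D i / b i) ^ (1 + a) with hc
  have hcb : ∀ i ∈ G, c i * b i = D i ^ (1 + a) * b i ^ (-a) := by
    intro i hi
    rw [hc]
    simp only
    rw [ENNReal.div_rpow_of_nonneg _ _ (by positivity), div_eq_mul_inv, ← ENNReal.rpow_neg,
      mul_assoc]
    congr 1
    nth_rewrite 2 [← ENNReal.rpow_one (b i)]
    rw [← ENNReal.rpow_add _ _ (hb0 i hi) (hbt i hi)]
    congr 1
    ring
  have hDc : ∀ i ∈ G, D i * c i ^ r = c i * b i := by
    intro i hi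
    rw [hcb i hi, hc]
    simp only
    rw [← ENNReal.rpow_mul, hra, ENNReal.div_rpow_of_nonneg _ _ ha0.le, div_eq_mul_inv,
      ← ENNReal.rpow_neg, ← mul_assoc, rpow_one_add ha0.le]
  obtain ⟨g, hgm, hgc, hgv⟩ := exists_sum_bump hv G x b c hb
  set S := ∑ i ∈ G, c i * b i with hS
  have hSt : S ≠ ∞ := by
    refine ENNReal.sum_ne_top.2 fun i hi => ?_
    refine ENNReal.mul_ne_top (ENNReal.rpow_ne_top_of_nonneg (by positivity)
      (ENNReal.div_ne_top (hDt i _) (hb0 i hi))) (hbt i hi)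
  have hpart : ∀ Q : ℕ → Set ℝ, (∀ i, MeasurableSet (Q i)) →
      Pairwise (Function.onFun Disjoint Q) → (∀ i, Q i ⊆ Iic (y i)) →
      ∑ i ∈ G, (∫⁻ t in Q i, kernel ω p t (x i) ∂μ) * c i ^ r ≤ (M * S) ^ r := by
    intro Q hQm hQd hQy
    calc _ ≤ ∑ i ∈ G, ∫⁻ t in Q i, kernel ω p t (x i) * (∫⁻ z in Ioi (x i), g z) ^ r ∂μ := by
          refine Finset.sum_le_sum fun i hi => ?_
          rw [lintegral_mul_const _ (continuous_kernel_left hω _).measurable]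
          gcongr
          exact hgc i hi
      _ ≤ supIntegral μ ω p r g := sum_setLIntegral_le_supIntegral G x Q hQm hQd
          (fun i hi t ht => (hQy i ht).trans_lt (hxy i hi)) g
      _ ≤ (M * ∫⁻ z in Ioi (0 : ℝ), g z * v z) ^ r := hM g hgm
      _ ≤ _ := by gcongr
  have hmain : S ≤ 2 * (2 ^ (p + 1) + 4) * M ^ r * S ^ r := by
    calc S = ∑ i ∈ G, D i * c i ^ r := Finset.sum_congr rfl fun i hi => (hDc i hi).symm
      _ ≤ ∑ i ∈ G, (2 ^ (p + 1) + 4) *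
          ((∫⁻ t in Ioc (y (i + 2)) (y (i + 1)), kernel ω p t (x i) ∂μ) * c i ^ r +
            (∫⁻ t in Ioc (y (i + 1)) (y i), kernel ω p t (x i) ∂μ) * c i ^ r) := by
          refine Finset.sum_le_sum fun i hi => ?_
          rw [← add_mul, ← lintegral_union measurableSet_Ioc
            (Ioc_disjoint_Ioc_of_le le_rfl), Ioc_union_Ioc_eq_Ioc (h.anti _) (h.anti _), ← mul_assoc]
          gcongr
          exact h.growth_le hμ hω hp i (hxy i hi).le
      _ ≤ (2 ^ (p + 1) + 4) * ((M * S) ^ r + (M * S) ^ r) := by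
          rw [← Finset.mul_sum, Finset.sum_add_distrib]
          gcongr
          · exact hpart _ (fun i => measurableSet_Ioc)
              (fun i j hij => h.pairwise_disjoint (show i + 1 ≠ j + 1 by omega))
              (fun i => Ioc_subset_Iic_self.trans (Iic_subset_Iic.2 (h.anti i)))
          · exact hpart _ (fun i => measurableSet_Ioc) h.pairwise_disjoint
              (fun i => Ioc_subset_Iic_self)
      _ = _ := by rw [ENNReal.mul_rpow_of_nonneg _ _ hr.le]; ring
  calc ∑ i ∈ G, l i ≤ S := Finset.sum_le_sum fun i hi => (hlb i hi).trans (hcb i hi).ge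
    _ ≤ (2 * (2 ^ (p + 1) + 4) * M ^ r) ^ (1 + a) :=
        le_rpow_of_le_mul_rpow hra' ha0.le hr hSt hmain
    _ = _ := by
        rw [ENNReal.mul_rpow_of_nonneg _ _ (by positivity), ← ENNReal.rpow_mul M, mul_comm r, hra]

/-- The constant of the lower bound for `r < 1`. -/
noncomputable def lowerConst (p a : ℝ) : ℝ≥0∞ :=
  2 * (2 * (2 * 2 ^ p + 2) ^ a + 2 * (2 ^ p * (1 + 2 ^ p) ^ a) * (1 + (2 ^ (p + 1)) ^ (1 + a))) *
    (2 * (2 ^ (p + 1) + 4)) ^ (1 + a)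

/-- The lower bound for the best constant when `r < 1`. -/
lemma MeasureHolds.lintegral_density_le {M : ℝ≥0∞} (hM : MeasureHolds μ ω p r v M) (hr : 0 < r)
    (hr1 : r < 1) (ha : a = r / (1 - r)) (hμ : IsWeightMeasure μ) (hω : IsWeightMeasure ω)
    (hp : 0 < p) (hv : Measurable v) :
    ∫⁻ t, density μ ω p a v t ∂μ ≤ lowerConst p a * M ^ a := by
  have h1r : 0 < 1 - r := by linarith
  have ha0 : 0 < a := by rw [ha]; positivity
  set c₁ : ℝ≥0∞ := 2 * (2 * 2 ^ p + 2) ^ a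
  set c₂ : ℝ≥0∞ := 2 * (2 ^ p * (1 + 2 ^ p) ^ a)
  set R : ℝ≥0∞ := 2 ^ (p + 1) with hRdef
  set K : ℝ≥0∞ := (2 * (2 ^ (p + 1) + 4)) ^ (1 + a) * M ^ a with hK
  have hR : R ≠ ∞ := by simp [hRdef]
  have hT : ∀ T : ℝ, 0 < T → ∫⁻ t in Ioc 0 T, density μ ω p a v t ∂μ ≤ lowerConst p a * M ^ a := by
    intro T hT
    obtain ⟨y, hy⟩ := exists_isScale hμ hω hp hR hT
    have hstep : ∀ n, ∫⁻ t in Ioc (y (n + 1)) (y n), density μ ω p a v t ∂μ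
        ≤ (c₁ + c₂ * (1 + R ^ (1 + a))) * (peak μ ω p a v (y n) + peak μ ω p a v (y (n + 1))) := by
      intro n
      rcases hy.sharp n with hn | hn
      · refine (setLIntegral_density_le_of_measure_le hω hp ha0.le hn).trans ?_
        exact mul_le_mul' le_self_add le_add_self
      · refine (setLIntegral_density_le_of_mass_le hω hp ha0.le hn).trans ?_
        refine le_trans ?_ (mul_le_mul' le_add_self le_rfl)
        rw [mul_assoc c₂]
        gcongr
        rw [add_mul, one_mul, mul_add]
        gcongr
        · exact le_self_add
        · exact le_add_self
    calc ∫⁻ t in Ioc 0 T, density μ ω p a v t ∂μ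
        ≤ ∫⁻ t in ⋃ n, Ioc (y (n + 1)) (y n), density μ ω p a v t ∂μ :=
          lintegral_mono_set (hy.Ioc_subset hμ)
      _ ≤ ∑' n, ∫⁻ t in Ioc (y (n + 1)) (y n), density μ ω p a v t ∂μ := lintegral_iUnion_le _ _
      _ ≤ (c₁ + c₂ * (1 + R ^ (1 + a))) * (K + K) := by
          refine ENNReal.tsum_le_of_sum_range_le fun n => ?_
          refine (Finset.sum_le_sum fun i _ => hstep i).trans ?_
          rw [← Finset.mul_sum, Finset.sum_add_distrib]
          gcongr
          · exact hM.sum_peak_le hr hr1 ha hμ hω hp hv hy _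
          · refine le_trans ?_ (hM.sum_peak_le hr hr1 ha hμ hω hp hv hy (Finset.range (n + 1)))
            rw [Finset.sum_range_succ']
            exact le_self_add
      _ = _ := by rw [lowerConst, hK]; ring
  have hU : ∫⁻ t, density μ ω p a v t ∂μ
      = ∫⁻ t in ⋃ n : ℕ, Ioc (0 : ℝ) (n + 1), density μ ω p a v t ∂μ := by
    rw [Measure.restrict_eq_self_of_ae_mem]
    filter_upwards [hμ.ae_pos] with t ht
    obtain ⟨n, hn⟩ := exists_nat_ge t
    exact mem_iUnion.2 ⟨n, ht, by linarith⟩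
  rw [hU, setLIntegral_iUnion_of_directed]
  · exact iSup_le fun n => hT _ (by positivity)
  · refine Monotone.directed_le fun m n hmn => Ioc_subset_Ioc_right ?_
    gcongr

end

/-! ### The upper bounds -/

section

variable {μ ω : Measure ℝ} {p a r : ℝ} {v : ℝ → ℝ≥0∞}

lemma measurable_slope_factor (hμ : IsWeightMeasure μ) (hω : IsWeightMeasure ω) (hp : 0 < p)
    (z : ℝ) :
    Measurable fun x => growth μ ω p x z ^ a * (growth μ ω p x z)⁻¹ * kernel ω p x z := by
  have hg : Measurable fun x => growth μ ω p x z :=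
    (measurable_growth hμ hω hp).comp measurable_prodMk_right
  exact ((hg.pow_const a).mul hg.inv).mul (continuous_kernel_left hω z).measurable

/-- A power of `A(z)` is controlled by its value at scale `t` and by an integral of the kernel over
`(t,z]`. If the part of `A(z)` collected up to `t` is not at least half of it, half of `A(z)` is
collected after the median point `x₀ > t`, and there `growth · z` is comparable to `A(z)`. -/
lemma mass_rpow_le (hμ : IsWeightMeasure μ) (hω : IsWeightMeasure ω) (hp : 0 < p) (ha : 0 ≤ a)
    {t z : ℝ} (ht : 0 < t) (htz : t ≤ z) :
    mass μ ω p z ^ a ≤ 4 * (2 * 2 ^ p) ^ a * (growth μ ω p t z ^ a +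
      ∫⁻ x in Ioc t z, growth μ ω p x z ^ a * (growth μ ω p x z)⁻¹ * kernel ω p x z ∂μ) := by
  have hm := (continuous_kernel_left (p := p) hω z).measurable
  have hA0 := (mass_pos hμ hω hp (ht.trans_le htz)).ne'
  have hAt := mass_ne_top hμ hω hp z
  set B : ℝ → ℝ≥0∞ := fun x => ∫⁻ s in Iic x, kernel ω p s z ∂μ with hB
  have hBz : B z = mass μ ω p z := setLIntegral_kernel_eq hp le_rfl
  have hBmono : Monotone B := fun x y hxy => lintegral_mono_set (Iic_subset_Iic.2 hxy)
  have hBc : Continuous B := by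
    have h := continuous_measure_Iic (μ := μ.withDensity fun s => kernel ω p s z)
      (fun x => withDensity_absolutelyContinuous _ _ (hμ.singleton x)) (fun x => ?_)
    · simpa only [withDensity_apply _ measurableSet_Iic] using h
    · rw [withDensity_apply _ measurableSet_Iic]
      exact (setLIntegral_le_lintegral _ _).trans_lt hAt.lt_top
  have hle : ∀ x, mass μ ω p z ≤ 2 * B x → mass μ ω p z ≤ 2 * 2 ^ p * growth μ ω p x z := by
    intro x hx
    rw [mul_assoc]
    exact hx.trans (by gcongr; exact setLIntegral_kernel_le_growth hω hp x z)
  rcases le_or_gt (mass μ ω p z) (2 * B t) with h | h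
  · calc mass μ ω p z ^ a ≤ (2 * 2 ^ p * growth μ ω p t z) ^ a := by gcongr; exact hle t h
      _ = 1 * (2 * 2 ^ p) ^ a * growth μ ω p t z ^ a := by
        rw [ENNReal.mul_rpow_of_nonneg _ _ ha, one_mul]
      _ ≤ _ := by
        gcongr
        · norm_num
        · exact le_self_add
  · obtain ⟨x₀, ⟨hx1, hx2⟩, hx0⟩ := intermediate_value_Icc htz
      ((ENNReal.continuous_const_mul (a := 2) (by simp)).comp hBc).continuousOn
      (show mass μ ω p z ∈ Icc (2 * B t) (2 * B z) from
        ⟨h.le, by rw [hBz, two_mul]; exact le_self_add⟩)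
    simp only [Function.comp_apply] at hx0
    have hhalf : mass μ ω p z ≤ 2 * ∫⁻ x in Ioc x₀ z, kernel ω p x z ∂μ := by
      have hsplit : mass μ ω p z = B x₀ + ∫⁻ x in Ioc x₀ z, kernel ω p x z ∂μ := by
        rw [← hBz, hB, ← lintegral_union measurableSet_Ioc (Iic_disjoint_Ioc le_rfl),
          Iic_union_Ioc_eq_Iic hx2]
      refine (ENNReal.add_le_add_iff_left hAt).1 ?_
      calc mass μ ω p z + mass μ ω p z = 2 * B x₀ + 2 * ∫⁻ x in Ioc x₀ z, kernel ω p x z ∂μ := by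
            rw [← mul_add, ← hsplit, two_mul]
        _ ≤ _ := by rw [hx0]
    calc mass μ ω p z ^ a = mass μ ω p z ^ a * (mass μ ω p z)⁻¹ * mass μ ω p z := by
          rw [mul_assoc, ENNReal.inv_mul_cancel hA0 hAt, mul_one]
      _ ≤ mass μ ω p z ^ a * (mass μ ω p z)⁻¹ * (2 * ∫⁻ x in Ioc x₀ z, kernel ω p x z ∂μ) := by
          gcongr
      _ = ∫⁻ x in Ioc x₀ z, 2 * (mass μ ω p z ^ a * (mass μ ω p z)⁻¹) * kernel ω p x z ∂μ := by
          rw [lintegral_const_mul _ hm]; ring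
      _ ≤ ∫⁻ x in Ioc x₀ z, 4 * (2 * 2 ^ p) ^ a *
          (growth μ ω p x z ^ a * (growth μ ω p x z)⁻¹ * kernel ω p x z) ∂μ := by
          refine setLIntegral_mono' measurableSet_Ioc fun x hx => ?_
          have h1 : mass μ ω p z ^ a ≤ (2 * 2 ^ p) ^ a * growth μ ω p x z ^ a := by
            rw [← ENNReal.mul_rpow_of_nonneg _ _ ha]
            gcongr
            exact hle x (hx0.ge.trans (by gcongr; exact hBmono hx.1.le))
          have h2 : (mass μ ω p z)⁻¹ ≤ 2 * (growth μ ω p x z)⁻¹ := by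
            calc (mass μ ω p z)⁻¹ = 2 * (2 * mass μ ω p z)⁻¹ := by
                  rw [ENNReal.mul_inv (by simp) (by simp), ← mul_assoc,
                    ENNReal.mul_inv_cancel (by simp) (by simp), one_mul]
              _ ≤ _ := by gcongr; exact growth_le_mass hp hx.2
          calc 2 * (mass μ ω p z ^ a * (mass μ ω p z)⁻¹) * kernel ω p x z
              ≤ 2 * ((2 * 2 ^ p) ^ a * growth μ ω p x z ^ a * (2 * (growth μ ω p x z)⁻¹)) *
                kernel ω p x z := by gcongr
            _ = _ := by ring
      _ = 4 * (2 * 2 ^ p) ^ a * ∫⁻ x in Ioc x₀ z,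
          growth μ ω p x z ^ a * (growth μ ω p x z)⁻¹ * kernel ω p x z ∂μ := by
          rw [lintegral_const_mul _ (measurable_slope_factor hμ hω hp z)]
      _ ≤ _ := by
          gcongr 4 * (2 * 2 ^ p) ^ a * ?_
          exact (lintegral_mono_set (Ioc_subset_Ioc_left hx1)).trans le_add_self

lemma measurable_density (hμ : IsWeightMeasure μ) (hω : IsWeightMeasure ω) (hp : 0 < p)
    (hv : Measurable v) : Measurable (density μ ω p a v) :=
  measurable_tailSup (f := fun y => growth μ ω p y.1 y.2 ^ a * kernel ω p y.1 y.2 * v y.2 ^ (-a))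
    ((((measurable_growth hμ hω hp).pow_const a).mul (measurable_kernel hω)).mul
      ((hv.comp measurable_snd).pow_const _))

/-- The variant of `density` in which `growth t z` is replaced by the larger `A(z)`. -/
noncomputable def fullDensity (μ ω : Measure ℝ) (p a : ℝ) (v : ℝ → ℝ≥0∞) (t : ℝ) : ℝ≥0∞ :=
  tailSup (fun z => kernel ω p t z * mass μ ω p z ^ a * v z ^ (-a)) t

/-- The factor `growth^a · growth⁻¹ · kernel · v^{-a}` which remains of the density when one factor
`growth` is removed. -/
noncomputable def slope (μ ω : Measure ℝ) (p a : ℝ) (v : ℝ → ℝ≥0∞) (x z : ℝ) : ℝ≥0∞ :=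
  growth μ ω p x z ^ a * (growth μ ω p x z)⁻¹ * kernel ω p x z * v z ^ (-a)

lemma measurable_slope (hμ : IsWeightMeasure μ) (hω : IsWeightMeasure ω) (hp : 0 < p)
    (hv : Measurable v) : Measurable fun y : ℝ × ℝ => slope μ ω p a v y.1 y.2 :=
  ((((measurable_growth hμ hω hp).pow_const a).mul (measurable_growth hμ hω hp).inv).mul
    (measurable_kernel hω)).mul ((hv.comp measurable_snd).pow_const _)

/-- The tail supremum of `slope`. -/
noncomputable def slopeSup (μ ω : Measure ℝ) (p a : ℝ) (v : ℝ → ℝ≥0∞) (x : ℝ) : ℝ≥0∞ :=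
  tailSup (fun z => slope μ ω p a v x z) x

/-- The tail supremum of the product of `kernel` and `slope`. -/
noncomputable def kernelSlopeSup (μ ω : Measure ℝ) (p a : ℝ) (v : ℝ → ℝ≥0∞) (x : ℝ) : ℝ≥0∞ :=
  tailSup (fun z => kernel ω p x z * slope μ ω p a v x z) x

lemma measurable_slopeSup (hμ : IsWeightMeasure μ) (hω : IsWeightMeasure ω) (hp : 0 < p)
    (hv : Measurable v) : Measurable (slopeSup μ ω p a v) :=
  measurable_tailSup (f := fun y => slope μ ω p a v y.1 y.2) (measurable_slope hμ hω hp hv)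

lemma measurable_kernelSlopeSup (hμ : IsWeightMeasure μ) (hω : IsWeightMeasure ω) (hp : 0 < p)
    (hv : Measurable v) : Measurable (kernelSlopeSup μ ω p a v) :=
  measurable_tailSup (f := fun y => kernel ω p y.1 y.2 * slope μ ω p a v y.1 y.2)
    ((measurable_kernel hω).mul (measurable_slope hμ hω hp hv))

lemma mul_slope_le {x z : ℝ} {c : ℝ≥0∞} (hc : c ≤ growth μ ω p x z) :
    c * slope μ ω p a v x z ≤ growth μ ω p x z ^ a * kernel ω p x z * v z ^ (-a) := by
  calc c * slope μ ω p a v x z = (c * (growth μ ω p x z)⁻¹) *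
        (growth μ ω p x z ^ a * kernel ω p x z * v z ^ (-a)) := by rw [slope]; ring
    _ ≤ 1 * _ := by
        gcongr
        exact (mul_le_mul_left hc _).trans (ENNReal.mul_inv_le_one _)
    _ = _ := one_mul _

lemma mass_mul_slopeSup_le (x : ℝ) :
    mass μ ω p x * slopeSup μ ω p a v x ≤ density μ ω p a v x := by
  rw [slopeSup, const_mul_tailSup]
  exact tailSup_mono fun z _ => mul_slope_le (mass_le_growth_left x z)

lemma measure_mul_kernelSlopeSup_le (x : ℝ) :
    μ (Iic x) * kernelSlopeSup μ ω p a v x ≤ density μ ω p a v x := by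
  rw [kernelSlopeSup, const_mul_tailSup]
  refine tailSup_mono fun z _ => ?_
  rw [← mul_assoc]
  exact mul_slope_le (measure_mul_kernel_le_growth x z)

/-- The pointwise estimate of `fullDensity` by `density` and two dual Hardy-type integrals. -/
lemma fullDensity_le [SFinite μ] (hμ : IsWeightMeasure μ) (hω : IsWeightMeasure ω) (hp : 0 < p)
    (ha : 0 ≤ a) (hv : Measurable v) {t : ℝ} (ht : 0 < t) :
    fullDensity μ ω p a v t ≤ 4 * (2 * 2 ^ p) ^ a * (density μ ω p a v t + 2 ^ p *
      (∫⁻ x, kernel ω p t x * slopeSup μ ω p a v x ∂μ +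
        ∫⁻ x in Ioi t, kernelSlopeSup μ ω p a v x ∂μ)) := by
  have hs := measurable_slope (a := a) hμ hω hp hv
  have hαm := measurable_slopeSup (a := a) hμ hω hp hv
  have hβm := measurable_kernelSlopeSup (a := a) hμ hω hp hv
  set α := slopeSup μ ω p a v
  set β := kernelSlopeSup μ ω p a v
  have hae : ∀ᵐ z, ∀ᵐ x ∂μ, x ≤ z →
      slope μ ω p a v x z ≤ α x ∧ kernel ω p x z * slope μ ω p a v x z ≤ β x := by
    rw [← Measure.ae_ae_comm]
    · refine Eventually.of_forall fun x => ?_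
      filter_upwards [ae_le_tailSup (fun z => slope μ ω p a v x z) x,
        ae_le_tailSup (fun z => kernel ω p x z * slope μ ω p a v x z) x] with z h1 h2 hxz
      exact ⟨h1 hxz, h2 hxz⟩
    · refine (measurableSet_le measurable_fst measurable_snd).imp ?_
      exact (measurableSet_le hs (hαm.comp measurable_fst)).inter
        (measurableSet_le ((measurable_kernel hω).mul hs) (hβm.comp measurable_fst))
  refine tailSup_le_iff.2 ?_
  filter_upwards [hae, ae_le_tailSup
    (fun z => growth μ ω p t z ^ a * kernel ω p t z * v z ^ (-a)) t] with z hz hd htz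
  have hint : ∫⁻ x in Ioc t z, kernel ω p t z * slope μ ω p a v x z ∂μ
      ≤ 2 ^ p * (∫⁻ x, kernel ω p t x * α x ∂μ + ∫⁻ x in Ioi t, β x ∂μ) := by
    have hm : Measurable fun x => kernel ω p t x * α x :=
      (continuous_kernel_right hω t).measurable.mul hαm
    calc ∫⁻ x in Ioc t z, kernel ω p t z * slope μ ω p a v x z ∂μ
        ≤ ∫⁻ x in Ioc t z, 2 ^ p * (kernel ω p t x * α x + β x) ∂μ := by
          refine setLIntegral_mono_ae' measurableSet_Ioc ?_
          filter_upwards [hz] with x hx hxt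
          calc kernel ω p t z * slope μ ω p a v x z
              ≤ 2 ^ p * (kernel ω p t x + kernel ω p x z) * slope μ ω p a v x z := by
                gcongr
                exact kernel_le hp.le t x z
            _ = 2 ^ p * (kernel ω p t x * slope μ ω p a v x z +
                kernel ω p x z * slope μ ω p a v x z) := by ring
            _ ≤ _ := by
                gcongr
                · exact (hx hxt.2).1
                · exact (hx hxt.2).2
      _ = 2 ^ p * (∫⁻ x in Ioc t z, kernel ω p t x * α x ∂μ + ∫⁻ x in Ioc t z, β x ∂μ) := by
          rw [lintegral_const_mul' _ _ (ENNReal.rpow_ne_top_of_nonneg hp.le (by simp)),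
            lintegral_add_left hm]
      _ ≤ _ := by
          gcongr
          · exact Measure.restrict_le_self
          · exact Ioc_subset_Ioi_self
  have hpull : kernel ω p t z * v z ^ (-a) *
      ∫⁻ x in Ioc t z, growth μ ω p x z ^ a * (growth μ ω p x z)⁻¹ * kernel ω p x z ∂μ
      = ∫⁻ x in Ioc t z, kernel ω p t z * slope μ ω p a v x z ∂μ := by
    rw [← lintegral_const_mul _ (measurable_slope_factor hμ hω hp z)]
    refine lintegral_congr fun x => ?_
    rw [slope]
    ring
  calc kernel ω p t z * mass μ ω p z ^ a * v z ^ (-a)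
      ≤ kernel ω p t z * (4 * (2 * 2 ^ p) ^ a * (growth μ ω p t z ^ a +
        ∫⁻ x in Ioc t z, growth μ ω p x z ^ a * (growth μ ω p x z)⁻¹ * kernel ω p x z ∂μ)) *
        v z ^ (-a) := by
        gcongr
        exact mass_rpow_le hμ hω hp ha ht htz
    _ = 4 * (2 * 2 ^ p) ^ a * (growth μ ω p t z ^ a * kernel ω p t z * v z ^ (-a) +
        kernel ω p t z * v z ^ (-a) *
        ∫⁻ x in Ioc t z, growth μ ω p x z ^ a * (growth μ ω p x z)⁻¹ * kernel ω p x z ∂μ) := by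
        ring
    _ ≤ _ := by
        rw [hpull]
        gcongr
        exact hd htz

lemma lintegral_fullDensity_le [SFinite μ] (hμ : IsWeightMeasure μ) (hω : IsWeightMeasure ω)
    (hp : 0 < p) (ha : 0 ≤ a) (hv : Measurable v) :
    ∫⁻ t, fullDensity μ ω p a v t ∂μ
      ≤ 4 * (2 * 2 ^ p) ^ a * (1 + 2 * 2 ^ p) * ∫⁻ t, density μ ω p a v t ∂μ := by
  have hdm := measurable_density (a := a) hμ hω hp hv
  have hαm := measurable_slopeSup (a := a) hμ hω hp hv
  have hβm := measurable_kernelSlopeSup (a := a) hμ hω hp hv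
  set α := slopeSup μ ω p a v
  set β := kernelSlopeSup μ ω p a v
  have hm1 : Measurable fun y : ℝ × ℝ => kernel ω p y.1 y.2 * α y.2 :=
    (measurable_kernel hω).mul (hαm.comp measurable_snd)
  have hm2 : Measurable fun y : ℝ × ℝ => (Ioi y.1).indicator β y.2 := by
    have : (fun y : ℝ × ℝ => (Ioi y.1).indicator β y.2) =
        {y : ℝ × ℝ | y.1 < y.2}.indicator fun y => β y.2 := by
      ext y
      simp [indicator]
    rw [this]
    exact (hβm.comp measurable_snd).indicator (measurableSet_lt measurable_fst measurable_snd)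
  have h1 : ∫⁻ t, ∫⁻ x, kernel ω p t x * α x ∂μ ∂μ ≤ ∫⁻ t, density μ ω p a v t ∂μ := by
    rw [lintegral_lintegral_swap hm1.aemeasurable]
    refine lintegral_mono fun x => ?_
    rw [lintegral_mul_const _ (continuous_kernel_left hω x).measurable]
    exact mass_mul_slopeSup_le x
  have h2 : ∫⁻ t, ∫⁻ x in Ioi t, β x ∂μ ∂μ ≤ ∫⁻ t, density μ ω p a v t ∂μ := by
    simp_rw [← lintegral_indicator measurableSet_Ioi]
    rw [lintegral_lintegral_swap hm2.aemeasurable]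
    refine lintegral_mono fun x => ?_
    calc ∫⁻ t, (Ioi t).indicator β x ∂μ ≤ ∫⁻ t, (Iic x).indicator (fun _ => β x) t ∂μ := by
          refine lintegral_mono fun t => ?_
          by_cases htx : t < x
          · simp [htx, htx.le]
          · simp [htx]
      _ = μ (Iic x) * β x := by
          rw [lintegral_indicator measurableSet_Iic, setLIntegral_const, mul_comm]
      _ ≤ _ := measure_mul_kernelSlopeSup_le x
  calc ∫⁻ t, fullDensity μ ω p a v t ∂μ
      ≤ ∫⁻ t, 4 * (2 * 2 ^ p) ^ a * (density μ ω p a v t + 2 ^ p *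
        (∫⁻ x, kernel ω p t x * α x ∂μ + ∫⁻ x in Ioi t, β x ∂μ)) ∂μ := by
        refine lintegral_mono_ae ?_
        filter_upwards [hμ.ae_pos] with t ht
        exact fullDensity_le hμ hω hp ha hv ht
    _ = 4 * (2 * 2 ^ p) ^ a * (∫⁻ t, density μ ω p a v t ∂μ + 2 ^ p *
        (∫⁻ t, ∫⁻ x, kernel ω p t x * α x ∂μ ∂μ + ∫⁻ t, ∫⁻ x in Ioi t, β x ∂μ ∂μ)) := by
        have hm1' : Measurable fun t => ∫⁻ x, kernel ω p t x * α x ∂μ := hm1.lintegral_prod_right'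
        have h2p : (2 : ℝ≥0∞) ^ p ≠ ∞ := ENNReal.rpow_ne_top_of_nonneg hp.le (by simp)
        have hc : 4 * (2 * (2 : ℝ≥0∞) ^ p) ^ a ≠ ∞ := ENNReal.mul_ne_top (by simp)
          (ENNReal.rpow_ne_top_of_nonneg ha (ENNReal.mul_ne_top (by simp) h2p))
        rw [lintegral_const_mul' _ _ hc, lintegral_add_left hdm, lintegral_const_mul' _ _ h2p,
          lintegral_add_left hm1']
    _ ≤ 4 * (2 * 2 ^ p) ^ a * (∫⁻ t, density μ ω p a v t ∂μ + 2 ^ p *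
        (∫⁻ t, density μ ω p a v t ∂μ + ∫⁻ t, density μ ω p a v t ∂μ)) := by gcongr
    _ = _ := by ring

/-- If `v` is finite almost everywhere, `A / v` does not vanish identically on a tail. -/
lemma tailSup_mass_mul_inv_ne_zero (hμ : IsWeightMeasure μ) (hω : IsWeightMeasure ω) (hp : 0 < p)
    (hvt : ∀ᵐ y, 0 < y → v y ≠ ∞) {s : ℝ} (hs : 0 < s) :
    tailSup (fun z => mass μ ω p z * (v z)⁻¹) s ≠ 0 := by
  intro h0
  have h1 : ∀ᵐ z, ¬ s ≤ z := by
    filter_upwards [tailSup_le_iff.1 h0.le, hvt] with z h1 h2 hz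
    have h3 := mul_eq_zero.1 (le_antisymm (h1 hz) zero_le)
    rcases h3 with h3 | h3
    · exact (mass_pos hμ hω hp (hs.trans_le hz)).ne' h3
    · exact h2 (hs.trans_le hz) (ENNReal.inv_eq_zero.1 h3)
  have h2 : volume (Ici s) = 0 := by
    rw [ae_iff] at h1
    simpa [Ici] using h1
  simp at h2

/-- The upper bound for `r < 1`: Hölder's inequality with the weight
`ψ(s) = ess sup_{z ≥ s} A(z) / v(z)`, whose reciprocal can be moved under the integral of `h`. -/
lemma measureHolds_of_fullDensity [SFinite μ] (hr : 0 < r) (hr1 : r < 1) (ha : a = r / (1 - r))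
    (hμ : IsWeightMeasure μ) (hω : IsWeightMeasure ω) (hp : 0 < p) (hv : Measurable v)
    (hvt : ∀ᵐ y, 0 < y → v y ≠ ∞) (he : ∫⁻ t, fullDensity μ ω p a v t ∂μ ≠ ∞) :
    MeasureHolds μ ω p r v ((∫⁻ t, fullDensity μ ω p a v t ∂μ) ^ (1 / a)) := by
  intro h hm
  have h1r : 0 < 1 - r := by linarith
  have ha0 : 0 < a := by rw [ha]; positivity
  have har : a * (1 - r) = r := by rw [ha]; field_simp
  have hAm := (continuous_mass hμ hω hp).measurable
  set ψ : ℝ → ℝ≥0∞ := tailSup (fun z => mass μ ω p z * (v z)⁻¹) with hψ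
  set F : ℝ → ℝ≥0∞ := fun t => ⨆ s ∈ Ioi t, kernel ω p t s * ψ s ^ a with hF
  set G : ℝ → ℝ≥0∞ :=
    fun t => ⨆ s ∈ Ioi t, kernel ω p t s * ((ψ s)⁻¹ * ∫⁻ y in Ioi s, h y) with hG
  have hFe : ∀ t, 0 < t → F t ≤ fullDensity μ ω p a v t := by
    intro t ht
    refine iSup₂_le fun s (hs : t < s) => ?_
    rcases eq_or_ne (kernel ω p t s) 0 with hk | hk
    · simp [hk]
    have hkt := kernel_ne_top hω hp.le t s
    have hψle : ψ s ≤ (fullDensity μ ω p a v t / kernel ω p t s) ^ (1 / a) := by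
      refine tailSup_le_iff.2 ?_
      filter_upwards [ae_le_tailSup
        (fun z => kernel ω p t z * mass μ ω p z ^ a * v z ^ (-a)) t] with z hz hsz
      rw [one_div, ENNReal.le_rpow_inv_iff ha0, ENNReal.le_div_iff_mul_le (Or.inl hk) (Or.inl hkt),
        ENNReal.mul_rpow_of_nonneg _ _ ha0.le, ENNReal.inv_rpow, ← ENNReal.rpow_neg]
      calc mass μ ω p z ^ a * v z ^ (-a) * kernel ω p t s
          ≤ mass μ ω p z ^ a * v z ^ (-a) * kernel ω p t z := by
            gcongr
            exact kernel_mono hp.le le_rfl hsz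
        _ = kernel ω p t z * mass μ ω p z ^ a * v z ^ (-a) := by ring
        _ ≤ _ := hz (hs.le.trans hsz)
    rw [one_div, ENNReal.le_rpow_inv_iff ha0, ENNReal.le_div_iff_mul_le (Or.inl hk) (Or.inl hkt),
      mul_comm] at hψle
    exact hψle
  have hGh : ∀ t, 0 < t → G t ≤
      ∫⁻ y in Ioi (0 : ℝ), kernel ω p t y * (h y * v y * (mass μ ω p y)⁻¹) := by
    intro t ht
    refine iSup₂_le fun s (hs : t < s) => ?_
    calc kernel ω p t s * ((ψ s)⁻¹ * ∫⁻ y in Ioi s, h y)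
        = ∫⁻ y in Ioi s, kernel ω p t s * (ψ s)⁻¹ * h y := by
          rw [lintegral_const_mul _ hm, mul_assoc]
      _ ≤ ∫⁻ y in Ioi s, kernel ω p t y * (h y * v y * (mass μ ω p y)⁻¹) := by
          refine setLIntegral_mono_ae' measurableSet_Ioi ?_
          filter_upwards [ae_le_tailSup (fun z => mass μ ω p z * (v z)⁻¹) s] with y hy hsy
          have hsy : s < y := hsy
          have hA0 := (mass_pos hμ hω hp (ht.trans (hs.trans hsy))).ne'
          have hAt := mass_ne_top hμ hω hp y
          have hinv : (ψ s)⁻¹ ≤ (mass μ ω p y)⁻¹ * v y := by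
            calc (ψ s)⁻¹ ≤ (mass μ ω p y * (v y)⁻¹)⁻¹ := by gcongr; exact hy hsy.le
              _ = _ := by rw [ENNReal.mul_inv (Or.inl hA0) (Or.inl hAt), inv_inv]
          calc kernel ω p t s * (ψ s)⁻¹ * h y
              ≤ kernel ω p t y * ((mass μ ω p y)⁻¹ * v y) * h y := by
                gcongr
                exact kernel_mono hp.le le_rfl hsy.le
            _ = _ := by ring
      _ ≤ _ := lintegral_mono_set (Ioi_subset_Ioi (ht.trans hs).le)
  have hGint : ∫⁻ t, G t ∂μ ≤ ∫⁻ y in Ioi (0 : ℝ), h y * v y := by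
    calc ∫⁻ t, G t ∂μ
        ≤ ∫⁻ t, (∫⁻ y in Ioi (0 : ℝ), kernel ω p t y * (h y * v y * (mass μ ω p y)⁻¹)) ∂μ := by
          refine lintegral_mono_ae ?_
          filter_upwards [hμ.ae_pos] with t ht using hGh t ht
      _ = ∫⁻ y in Ioi (0 : ℝ), (∫⁻ t, kernel ω p t y * (h y * v y * (mass μ ω p y)⁻¹) ∂μ) := by
          refine lintegral_lintegral_swap (Measurable.aemeasurable ?_)
          exact (measurable_kernel hω).mul
            ((((hm.mul hv).mul hAm.inv)).comp measurable_snd)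
      _ ≤ _ := by
          refine setLIntegral_mono' measurableSet_Ioi fun y (hy : 0 < y) => ?_
          rw [lintegral_mul_const _ (continuous_kernel_left hω y).measurable]
          change mass μ ω p y * _ ≤ _
          rw [mul_comm, mul_assoc, ENNReal.inv_mul_cancel (mass_pos hμ hω hp hy).ne'
            (mass_ne_top hμ hω hp y), mul_one]
  have hem : Measurable (fullDensity μ ω p a v) :=
    measurable_tailSup (f := fun y => kernel ω p y.1 y.2 * mass μ ω p y.2 ^ a * v y.2 ^ (-a))
      (((measurable_kernel hω).mul ((hAm.comp measurable_snd).pow_const a)).mul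
        ((hv.comp measurable_snd).pow_const _))
  have hpt : ∀ᵐ t ∂μ, (⨆ s ∈ Ioi t, kernel ω p t s * (∫⁻ y in Ioi s, h y) ^ r)
      ≤ F t ^ (1 - r) * G t ^ r := by
    filter_upwards [hμ.ae_pos, ae_lt_top hem he] with t ht het
    refine iSup₂_le fun s (hs : t < s) => ?_
    rcases eq_or_ne (kernel ω p t s) 0 with hk | hk
    · simp [hk]
    have hkt := kernel_ne_top hω hp.le t s
    have hFs : kernel ω p t s * ψ s ^ a ≤ F t := le_iSup₂_of_le s hs le_rfl
    have hψ0 : ψ s ≠ 0 := tailSup_mass_mul_inv_ne_zero hμ hω hp hvt (ht.trans hs)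
    have hψt : ψ s ≠ ∞ := by
      intro htop
      rw [htop, ENNReal.top_rpow_of_pos ha0, ENNReal.mul_top hk] at hFs
      exact het.not_ge (hFs.trans (hFe t ht))
    calc kernel ω p t s * (∫⁻ y in Ioi s, h y) ^ r
        = (kernel ω p t s * ψ s ^ a) ^ (1 - r) *
          (kernel ω p t s * ((ψ s)⁻¹ * ∫⁻ y in Ioi s, h y)) ^ r := by
          rw [ENNReal.mul_rpow_of_nonneg _ _ h1r.le, ENNReal.mul_rpow_of_nonneg _ _ hr.le,
            ENNReal.mul_rpow_of_nonneg _ _ hr.le, ← ENNReal.rpow_mul, har, ENNReal.inv_rpow]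
          have hk1 : kernel ω p t s = kernel ω p t s ^ (1 - r) * kernel ω p t s ^ r := by
            rw [← ENNReal.rpow_add _ _ hk hkt, sub_add_cancel, ENNReal.rpow_one]
          have hψ1 : ψ s ^ r * (ψ s ^ r)⁻¹ = 1 := ENNReal.mul_inv_cancel
            (ENNReal.rpow_pos (pos_iff_ne_zero.2 hψ0) hψt).ne'
            (ENNReal.rpow_ne_top_of_nonneg hr.le hψt)
          nth_rewrite 1 [hk1]
          calc _ = kernel ω p t s ^ (1 - r) * kernel ω p t s ^ r * 1 *
                (∫⁻ y in Ioi s, h y) ^ r := by rw [mul_one]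
            _ = _ := by rw [← hψ1]; ring
      _ ≤ _ := by
          gcongr
          exact le_iSup₂_of_le (f := fun s (_ : s ∈ Ioi t) =>
            kernel ω p t s * ((ψ s)⁻¹ * ∫⁻ y in Ioi s, h y)) s hs le_rfl
  have hanti : ∀ f : ℝ → ℝ≥0∞, Antitone fun t => ⨆ s ∈ Ioi t, kernel ω p t s * f s := by
    intro f t t' htt
    refine iSup₂_le fun s (hs : t' < s) => le_iSup₂_of_le s (htt.trans_lt hs) ?_
    gcongr
    exact kernel_mono hp.le htt le_rfl
  calc supIntegral μ ω p r h ≤ ∫⁻ t, F t ^ (1 - r) * G t ^ r ∂μ := lintegral_mono_ae hpt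
    _ ≤ (∫⁻ t, F t ∂μ) ^ (1 - r) * (∫⁻ t, G t ∂μ) ^ r :=
        ENNReal.lintegral_mul_norm_pow_le (hanti _).measurable.aemeasurable
          (hanti _).measurable.aemeasurable h1r.le hr.le (by ring)
    _ ≤ (∫⁻ t, fullDensity μ ω p a v t ∂μ) ^ (1 - r) *
        (∫⁻ y in Ioi (0 : ℝ), h y * v y) ^ r := by
        refine mul_le_mul' (ENNReal.rpow_le_rpow (lintegral_mono_ae ?_) h1r.le)
          (ENNReal.rpow_le_rpow hGint hr.le)
        filter_upwards [hμ.ae_pos] with t ht using hFe t ht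
    _ = _ := by
        rw [ENNReal.mul_rpow_of_nonneg _ _ hr.le, ← ENNReal.rpow_mul]
        congr 2
        rw [ha]
        field_simp

/-- The upper bound for `r ≥ 1`: Minkowski's inequality in the form of Hölder's inequality for the
measure `h v dy`. -/
lemma measureHolds_of_one_le [SFinite μ] (hr : 1 ≤ r) (hμ : IsWeightMeasure μ)
    (hω : IsWeightMeasure ω) (hp : 0 < p) (hv : Measurable v)
    (hvt : ∀ᵐ y, 0 < y → v y ≠ ∞) {M : ℝ≥0∞} (hMt : M ≠ ∞)
    (hM : ∀ t, 0 < t → mass μ ω p t ^ (1 / r) * tailSup (fun z => (v z)⁻¹) t ≤ M) :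
    MeasureHolds μ ω p r v M := by
  intro h hm
  have hr0 : 0 < r := by linarith
  have hr1 : 0 ≤ 1 / r := by positivity
  have hr2 : 0 ≤ 1 - 1 / r := by
    rw [sub_nonneg, div_le_one hr0]; exact hr
  have hae : ∀ᵐ y, 0 < y → v y ≠ 0 ∧ v y ≠ ∞ ∧ mass μ ω p y ≤ M ^ r * v y ^ r := by
    have h1 := (tailSup_mul_le_iSup (ENNReal.continuous_rpow_const.comp
      (continuous_mass hμ hω hp)) (fun z => (v z)⁻¹) 0).trans
      (iSup₂_le fun t ht => hM t ht)
    filter_upwards [tailSup_le_iff.1 h1, hvt] with y hy hvy hy0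
    have hy := hy hy0.le
    simp only [Function.comp_apply] at hy
    have hA0 := (ENNReal.rpow_pos (mass_pos hμ hω hp hy0) (mass_ne_top hμ hω hp y)
      (p := 1 / r)).ne'
    have hv0 : v y ≠ 0 := by
      intro h0
      rw [h0, ENNReal.inv_zero, ENNReal.mul_top hA0] at hy
      exact hMt (top_le_iff.1 hy)
    refine ⟨hv0, hvy hy0, ?_⟩
    rw [← div_eq_mul_inv, ENNReal.div_le_iff hv0 (hvy hy0), one_div,
      ENNReal.rpow_inv_le_iff hr0, ENNReal.mul_rpow_of_nonneg _ _ hr0.le] at hy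
    exact hy
  set I := ∫⁻ y in Ioi (0 : ℝ), h y * v y with hI
  have hpt : ∀ t, 0 < t → (⨆ s ∈ Ioi t, kernel ω p t s * (∫⁻ y in Ioi s, h y) ^ r)
      ≤ (∫⁻ y in Ioi (0 : ℝ), kernel ω p t y * (v y ^ (1 - r) * h y)) * I ^ (r - 1) := by
    intro t ht
    have hsup : (⨆ s ∈ Ioi t, kernel ω p t s * (∫⁻ y in Ioi s, h y) ^ r)
        ≤ (∫⁻ y in Ioi (0 : ℝ), kernel ω p t y ^ (1 / r) * h y) ^ r := by
      refine iSup₂_le fun s (hs : t < s) => ?_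
      calc kernel ω p t s * (∫⁻ y in Ioi s, h y) ^ r
          = (∫⁻ y in Ioi s, kernel ω p t s ^ (1 / r) * h y) ^ r := by
            rw [lintegral_const_mul _ hm, ENNReal.mul_rpow_of_nonneg _ _ hr0.le,
              ← ENNReal.rpow_mul, one_div_mul_cancel hr0.ne', ENNReal.rpow_one]
        _ ≤ (∫⁻ y in Ioi s, kernel ω p t y ^ (1 / r) * h y) ^ r := by
            refine ENNReal.rpow_le_rpow (setLIntegral_mono' measurableSet_Ioi fun y hy => ?_) hr0.le
            gcongr
            exact kernel_mono hp.le le_rfl (le_of_lt hy)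
        _ ≤ _ := by
            refine ENNReal.rpow_le_rpow (lintegral_mono_set ?_) hr0.le
            exact Ioi_subset_Ioi (ht.trans hs).le
    refine hsup.trans ?_
    have heq : ∫⁻ y in Ioi (0 : ℝ), kernel ω p t y ^ (1 / r) * h y =
        ∫⁻ y in Ioi (0 : ℝ), (kernel ω p t y * (v y ^ (1 - r) * h y)) ^ (1 / r) *
          (h y * v y) ^ (1 - 1 / r) := by
      refine setLIntegral_congr_fun_ae measurableSet_Ioi ?_
      filter_upwards [hae] with y hy hy0
      obtain ⟨hv0, hvt, -⟩ := hy hy0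
      have e1 : h y = h y ^ (1 / r) * h y ^ (1 - 1 / r) := by
        rw [← ENNReal.rpow_add_of_nonneg _ _ hr1 hr2, add_sub_cancel, ENNReal.rpow_one]
      have e2 : (v y ^ (1 - r)) ^ (1 / r) * v y ^ (1 - 1 / r) = 1 := by
        rw [← ENNReal.rpow_mul, ← ENNReal.rpow_add _ _ hv0 hvt]
        rw [show (1 - r) * (1 / r) + (1 - 1 / r) = 0 by field_simp; ring, ENNReal.rpow_zero]
      rw [ENNReal.mul_rpow_of_nonneg _ _ hr1, ENNReal.mul_rpow_of_nonneg _ _ hr1,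
        ENNReal.mul_rpow_of_nonneg _ _ hr2]
      calc kernel ω p t y ^ (1 / r) * h y
          = kernel ω p t y ^ (1 / r) * (h y ^ (1 / r) * h y ^ (1 - 1 / r)) * 1 := by
            rw [← e1, mul_one]
        _ = _ := by rw [← e2]; ring
    have hk : Measurable fun y => kernel ω p t y := (continuous_kernel_right hω t).measurable
    calc (∫⁻ y in Ioi (0 : ℝ), kernel ω p t y ^ (1 / r) * h y) ^ r
        ≤ ((∫⁻ y in Ioi (0 : ℝ), kernel ω p t y * (v y ^ (1 - r) * h y)) ^ (1 / r) *
          I ^ (1 - 1 / r)) ^ r := by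
          rw [heq]
          refine ENNReal.rpow_le_rpow ?_ hr0.le
          exact ENNReal.lintegral_mul_norm_pow_le
            (hk.mul ((hv.pow_const _).mul hm)).aemeasurable (hm.mul hv).aemeasurable hr1 hr2
            (by ring)
      _ = _ := by
          rw [ENNReal.mul_rpow_of_nonneg _ _ hr0.le, ← ENNReal.rpow_mul, ← ENNReal.rpow_mul,
            one_div_mul_cancel hr0.ne', ENNReal.rpow_one, sub_mul, one_mul,
            one_div_mul_cancel hr0.ne']
  have hfm : Measurable fun y => v y ^ (1 - r) * h y := (hv.pow_const _).mul hm
  have hkm : Measurable fun z : ℝ × ℝ => kernel ω p z.1 z.2 * (v z.2 ^ (1 - r) * h z.2) :=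
    (measurable_kernel hω).mul (hfm.comp measurable_snd)
  calc supIntegral μ ω p r h
      ≤ ∫⁻ t, (∫⁻ y in Ioi (0 : ℝ), kernel ω p t y * (v y ^ (1 - r) * h y)) * I ^ (r - 1) ∂μ := by
        refine lintegral_mono_ae ?_
        filter_upwards [hμ.ae_pos] with t ht using hpt t ht
    _ = (∫⁻ y in Ioi (0 : ℝ), mass μ ω p y * (v y ^ (1 - r) * h y)) * I ^ (r - 1) := by
        rw [lintegral_mul_const _ hkm.lintegral_prod_right', lintegral_lintegral_swap
          hkm.aemeasurable]
        congr 1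
        refine lintegral_congr fun y => ?_
        exact lintegral_mul_const (v y ^ (1 - r) * h y)
          (continuous_kernel_left (p := p) hω y).measurable
    _ ≤ M ^ r * I * I ^ (r - 1) := by
        gcongr
        rw [hI, ← lintegral_const_mul _ (show Measurable fun y => h y * v y from hm.mul hv)]
        refine setLIntegral_mono_ae' measurableSet_Ioi ?_
        filter_upwards [hae] with y hy hy0
        obtain ⟨hv0, hvt, hA⟩ := hy hy0
        calc mass μ ω p y * (v y ^ (1 - r) * h y)
            ≤ M ^ r * v y ^ r * (v y ^ (1 - r) * h y) := by gcongr
          _ = M ^ r * ((v y ^ r * v y ^ (1 - r)) * h y) := by ring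
          _ = _ := by
            rw [← ENNReal.rpow_add _ _ hv0 hvt, add_sub_cancel, ENNReal.rpow_one, mul_comm (h y)]
    _ = (M * I) ^ r := by
        rw [ENNReal.mul_rpow_of_nonneg _ _ hr0.le, mul_assoc]
        congr 1
        nth_rewrite 1 [← ENNReal.rpow_one I]
        rw [← ENNReal.rpow_add_of_nonneg _ _ zero_le_one (by linarith), add_sub_cancel]

end

/-! ### Comparison with the constants of the theorem -/

section

variable {μ ω : Measure ℝ} {p a r q : ℝ} {v : ℝ → ℝ≥0∞}

/-- The integrand of `E₁`, without the factor `u`. -/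
noncomputable def densityE₁ (μ ω : Measure ℝ) (p a : ℝ) (v : ℝ → ℝ≥0∞) (t : ℝ) : ℝ≥0∞ :=
  μ (Iic t) ^ a * tailSup (fun z => kernel ω p t z ^ (1 + a) * v z ^ (-a)) t

/-- The integrand of `E₂`, without the factor `u`. -/
noncomputable def densityE₂ (μ ω : Measure ℝ) (p a : ℝ) (v : ℝ → ℝ≥0∞) (t : ℝ) : ℝ≥0∞ :=
  mass μ ω p t ^ a * tailSup (fun z => kernel ω p t z * v z ^ (-a)) t

lemma densityE₁_le (ha : 0 ≤ a) (t : ℝ) : densityE₁ μ ω p a v t ≤ density μ ω p a v t := by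
  rw [densityE₁, const_mul_tailSup]
  refine tailSup_mono fun z _ => ?_
  calc μ (Iic t) ^ a * (kernel ω p t z ^ (1 + a) * v z ^ (-a))
      = (μ (Iic t) * kernel ω p t z) ^ a * kernel ω p t z * v z ^ (-a) := by
        rw [rpow_one_add ha, ENNReal.mul_rpow_of_nonneg _ _ ha]; ring
    _ ≤ _ := by gcongr; exact measure_mul_kernel_le_growth t z

lemma densityE₂_le (ha : 0 ≤ a) (t : ℝ) : densityE₂ μ ω p a v t ≤ density μ ω p a v t := by
  rw [densityE₂, const_mul_tailSup]
  refine tailSup_mono fun z _ => ?_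
  rw [← mul_assoc]
  gcongr
  exact mass_le_growth_left t z

lemma density_le (ha : 0 ≤ a) (t : ℝ) :
    density μ ω p a v t ≤ 2 ^ a * (densityE₁ μ ω p a v t + densityE₂ μ ω p a v t) := by
  rw [densityE₁, densityE₂, const_mul_tailSup, const_mul_tailSup]
  refine le_trans ?_ (mul_le_mul' le_rfl (add_comm _ _).le)
  refine le_trans ?_ (mul_le_mul' le_rfl (tailSup_add_le _ _ t))
  rw [const_mul_tailSup]
  refine tailSup_mono fun z _ => ?_
  calc growth μ ω p t z ^ a * kernel ω p t z * v z ^ (-a)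
      ≤ 2 ^ a * (mass μ ω p t ^ a + (μ (Iic t) * kernel ω p t z) ^ a) *
        kernel ω p t z * v z ^ (-a) := by
        gcongr
        exact add_rpow_le_two_rpow_mul ha _ _
    _ = _ := by rw [rpow_one_add ha, ENNReal.mul_rpow_of_nonneg _ _ ha]; ring

lemma lintegral_density_le_add (hω : IsWeightMeasure ω) (hμ : IsWeightMeasure μ) (hp : 0 < p)
    (ha : 0 ≤ a) (hv : Measurable v) :
    ∫⁻ t, density μ ω p a v t ∂μ
      ≤ 2 ^ a * (∫⁻ t, densityE₁ μ ω p a v t ∂μ + ∫⁻ t, densityE₂ μ ω p a v t ∂μ) := by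
  have hm : Measurable (densityE₂ μ ω p a v) :=
    ((continuous_mass hμ hω hp).measurable.pow_const a).mul
      (measurable_tailSup (f := fun y => kernel ω p y.1 y.2 * v y.2 ^ (-a))
        ((measurable_kernel hω).mul ((hv.comp measurable_snd).pow_const _)))
  calc _ ≤ _ := lintegral_mono fun t => density_le ha t
    _ = _ := by
      rw [lintegral_const_mul' _ _ (ENNReal.rpow_ne_top_of_nonneg ha (by simp)),
        lintegral_add_right _ hm]

/-- The constant of the upper bound for `r < 1`. -/
noncomputable def upperConst (p a : ℝ) : ℝ≥0∞ :=
  (4 * (2 * 2 ^ p) ^ a * (1 + 2 * 2 ^ p) * 2 ^ a) ^ (1 / a) * 2 ^ (1 / a)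

lemma exists_measureHolds [SFinite μ] (hr : 0 < r) (hr1 : r < 1) (ha : a = r / (1 - r))
    (hμ : IsWeightMeasure μ) (hω : IsWeightMeasure ω) (hp : 0 < p) (hv : Measurable v)
    (hvt : ∀ᵐ y, 0 < y → v y ≠ ∞) (h1 : ∫⁻ t, densityE₁ μ ω p a v t ∂μ ≠ ∞)
    (h2 : ∫⁻ t, densityE₂ μ ω p a v t ∂μ ≠ ∞) :
    ∃ M ≠ ∞, MeasureHolds μ ω p r v M ∧
      M ≤ upperConst p a * ((∫⁻ t, densityE₁ μ ω p a v t ∂μ) ^ (1 / a) +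
        (∫⁻ t, densityE₂ μ ω p a v t ∂μ) ^ (1 / a)) := by
  have ha0 : 0 < a := by
    have : 0 < 1 - r := by linarith
    rw [ha]; positivity
  have ha1 : 0 ≤ 1 / a := by positivity
  set K : ℝ≥0∞ := 4 * (2 * 2 ^ p) ^ a * (1 + 2 * 2 ^ p) * 2 ^ a with hK
  have hKt : K ≠ ∞ := by
    have h2p : (2 : ℝ≥0∞) ^ p ≠ ∞ := ENNReal.rpow_ne_top_of_nonneg hp.le (by simp)
    have h2a : (2 : ℝ≥0∞) ^ a ≠ ∞ := ENNReal.rpow_ne_top_of_nonneg ha0.le (by simp)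
    have h22 : 2 * (2 : ℝ≥0∞) ^ p ≠ ∞ := ENNReal.mul_ne_top (by simp) h2p
    exact ENNReal.mul_ne_top (ENNReal.mul_ne_top (ENNReal.mul_ne_top (by simp)
      (ENNReal.rpow_ne_top_of_nonneg ha0.le h22)) (ENNReal.add_ne_top.2 ⟨by simp, h22⟩)) h2a
  set I₁ := ∫⁻ t, densityE₁ μ ω p a v t ∂μ
  set I₂ := ∫⁻ t, densityE₂ μ ω p a v t ∂μ
  have hle : ∫⁻ t, fullDensity μ ω p a v t ∂μ ≤ K * (I₁ + I₂) := by
    refine (lintegral_fullDensity_le hμ hω hp ha0.le hv).trans ?_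
    rw [hK, mul_assoc _ (2 ^ a)]
    gcongr
    exact lintegral_density_le_add hω hμ hp ha0.le hv
  have hfin : ∫⁻ t, fullDensity μ ω p a v t ∂μ ≠ ∞ :=
    ne_top_of_le_ne_top (ENNReal.mul_ne_top hKt (ENNReal.add_ne_top.2 ⟨h1, h2⟩)) hle
  refine ⟨_, ENNReal.rpow_ne_top_of_nonneg ha1 hfin,
    measureHolds_of_fullDensity hr hr1 ha hμ hω hp hv hvt hfin, ?_⟩
  calc (∫⁻ t, fullDensity μ ω p a v t ∂μ) ^ (1 / a) ≤ (K * (I₁ + I₂)) ^ (1 / a) := by gcongr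
    _ = K ^ (1 / a) * (I₁ + I₂) ^ (1 / a) := ENNReal.mul_rpow_of_nonneg _ _ ha1
    _ ≤ K ^ (1 / a) * (2 ^ (1 / a) * (I₁ ^ (1 / a) + I₂ ^ (1 / a))) := by
        gcongr
        exact add_rpow_le_two_rpow_mul ha1 _ _
    _ = _ := by rw [upperConst, mul_assoc]

lemma MeasureHolds.add_le {M : ℝ≥0∞} (hM : MeasureHolds μ ω p r v M) (hr : 0 < r)
    (hr1 : r < 1) (ha : a = r / (1 - r)) (hμ : IsWeightMeasure μ) (hω : IsWeightMeasure ω)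
    (hp : 0 < p) (hv : Measurable v) :
    (∫⁻ t, densityE₁ μ ω p a v t ∂μ) ^ (1 / a) + (∫⁻ t, densityE₂ μ ω p a v t ∂μ) ^ (1 / a)
      ≤ 2 * lowerConst p a ^ (1 / a) * M := by
  have ha0 : 0 < a := by
    have : 0 < 1 - r := by linarith
    rw [ha]; positivity
  have key := hM.lintegral_density_le hr hr1 ha hμ hω hp hv
  have h : ∀ f : ℝ → ℝ≥0∞, (∀ t, f t ≤ density μ ω p a v t) →
      (∫⁻ t, f t ∂μ) ^ (1 / a) ≤ lowerConst p a ^ (1 / a) * M := by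
    intro f hf
    calc (∫⁻ t, f t ∂μ) ^ (1 / a) ≤ (lowerConst p a * M ^ a) ^ (1 / a) :=
          ENNReal.rpow_le_rpow ((lintegral_mono hf).trans key) (by positivity)
      _ = _ := by
          rw [ENNReal.mul_rpow_of_nonneg _ _ (by positivity), ← ENNReal.rpow_mul,
            mul_one_div_cancel ha0.ne', ENNReal.rpow_one]
  calc _ ≤ lowerConst p a ^ (1 / a) * M + lowerConst p a ^ (1 / a) * M :=
        add_le_add (h _ (densityE₁_le ha0.le)) (h _ (densityE₂_le ha0.le))
    _ = _ := by ring

/-- For `r ≥ 1` both suprema are at most `ess sup A^{1/r} / v`, which is at most any admissible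
constant. -/
lemma MeasureHolds.measure_rpow_mul_tailSup_le {M : ℝ≥0∞} (hM : MeasureHolds μ ω p r v M)
    (hr : 0 < r) (hμ : IsWeightMeasure μ) (hω : IsWeightMeasure ω) (hp : 0 < p)
    (hv : Measurable v) {t : ℝ} (ht : 0 < t) :
    μ (Iic t) ^ (1 / r) * tailSup (fun z => kernel ω p t z ^ (1 / r) * (v z)⁻¹) t ≤ M := by
  have h1 : tailSup (fun z => mass μ ω p z ^ (1 / r) * (v z)⁻¹) 0 ≤ M :=
    (tailSup_mul_le_iSup (ENNReal.continuous_rpow_const.comp (continuous_mass hμ hω hp))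
      (fun z => (v z)⁻¹) 0).trans
      (iSup₂_le fun s hs => hM.mass_rpow_mul_tailSup_le hr hμ hω hp hv hs)
  refine le_trans ?_ ((tailSup_antitone _ ht.le).trans h1)
  rw [const_mul_tailSup]
  refine tailSup_mono fun z _ => ?_
  rw [← mul_assoc, ← ENNReal.mul_rpow_of_nonneg _ _ (by positivity)]
  gcongr
  exact measure_mul_kernel_le_mass hp.le t z

end

/-- The measure `u dt` on `(0,∞)`. -/
noncomputable def weightMeasure (u : ℝ → ℝ≥0∞) : Measure ℝ :=
  (volume.restrict (Ioi (0 : ℝ))).withDensity u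

instance (u : ℝ → ℝ≥0∞) : SFinite (weightMeasure u) := by
  unfold weightMeasure
  infer_instance

lemma weightMeasure_apply (u : ℝ → ℝ≥0∞) {s : Set ℝ} (hs : MeasurableSet s) :
    weightMeasure u s = ∫⁻ t in s ∩ Ioi 0, u t := by
  rw [weightMeasure, withDensity_apply _ hs, Measure.restrict_restrict hs]

lemma weightMeasure_Ioc (u : ℝ → ℝ≥0∞) {x : ℝ} (hx : 0 ≤ x) (t : ℝ) :
    weightMeasure u (Ioc x t) = ∫⁻ y in Ioc x t, u y := by
  rw [weightMeasure_apply u measurableSet_Ioc,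
    inter_eq_left.2 (Ioc_subset_Ioi_self.trans (Ioi_subset_Ioi hx))]

lemma weightMeasure_Iic (u : ℝ → ℝ≥0∞) (t : ℝ) :
    weightMeasure u (Iic t) = ∫⁻ y in Ioc 0 t, u y := by
  rw [weightMeasure_apply u measurableSet_Iic, inter_comm, Ioi_inter_Iic]

lemma IsWeight.isWeightMeasure {u : ℝ → ℝ≥0∞} (hu : IsWeight u) :
    IsWeightMeasure (weightMeasure u) where
  null := by simp [weightMeasure_Iic]
  singleton x := by
    refine withDensity_absolutelyContinuous _ _ ?_
    exact Measure.absolutelyContinuous_of_le Measure.restrict_le_self (by simp)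
  lt_top t := by
    rw [weightMeasure_Iic]
    rcases le_or_gt t 0 with h | h
    · simp [Ioc_eq_empty (not_lt.2 h)]
    · exact hu.lt_top t h
  pos t ht := by
    rw [weightMeasure_Iic]
    exact hu.pos t ht

lemma IsWeight.ae_lt_top {u : ℝ → ℝ≥0∞} (hu : IsWeight u) :
    ∀ᵐ t ∂(volume.restrict (Ioi (0 : ℝ))), u t < ∞ := by
  have hU : Ioi (0 : ℝ) = ⋃ n : ℕ, Ioc (0 : ℝ) (n + 1) := by
    ext t
    simp only [mem_Ioi, mem_iUnion, mem_Ioc, exists_and_left, iff_self_and]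
    intro _
    obtain ⟨n, hn⟩ := exists_nat_ge t
    exact ⟨n, by linarith⟩
  rw [hU, ae_restrict_iUnion_iff]
  intro n
  refine ae_lt_top' (hu.memMPlus.mono_set Ioc_subset_Ioi_self) (hu.lt_top _ ?_).ne
  positivity

lemma IsWeight.lintegral_weightMeasure {u : ℝ → ℝ≥0∞} (hu : IsWeight u) (f : ℝ → ℝ≥0∞) :
    ∫⁻ t, f t ∂(weightMeasure u) = ∫⁻ t in Ioi (0 : ℝ), u t * f t :=
  lintegral_withDensity_eq_lintegral_mul_non_measurable₀ _ hu.memMPlus hu.ae_lt_top f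

lemma kernel_weightMeasure (w : ℝ → ℝ≥0∞) (p : ℝ) {x : ℝ} (hx : 0 ≤ x) (t : ℝ) :
    kernel (weightMeasure w) p x t = (∫⁻ y in Ioc x t, w y) ^ p := by
  rw [kernel, weightMeasure_Ioc w hx]

lemma mass_weightMeasure {u w : ℝ → ℝ≥0∞} (hu : IsWeight u) {p : ℝ} (hp : 0 < p) (t : ℝ) :
    mass (weightMeasure u) (weightMeasure w) p t =
      ∫⁻ x in Ioc 0 t, u x * (∫⁻ y in Ioc x t, w y) ^ p := by
  have h : ∀ x ∈ Ioc 0 t, u x * (∫⁻ y in Ioc x t, w y) ^ p =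
      u x * kernel (weightMeasure w) p x t :=
    fun x hx => by rw [kernel_weightMeasure w p hx.1.le]
  rw [setLIntegral_congr_fun measurableSet_Ioc h, mass, hu.lintegral_weightMeasure,
    ← Ioi_inter_Iic, inter_comm, ← Measure.restrict_restrict measurableSet_Iic]
  refine (setLIntegral_eq_of_support_subset fun x hx => ?_).symm
  by_contra hx'
  exact hx (by simp [kernel_eq_zero hp (le_of_lt (not_le.1 hx'))])

lemma lhs_eq {q r : ℝ} {u w : ℝ → ℝ≥0∞} (hu : IsWeight u) (h : ℝ → ℝ≥0∞) :
    lhs q r u w h =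
      supIntegral (weightMeasure u) (weightMeasure w) (r / q) r h ^ (1 / r) := by
  rw [lhs, supIntegral, hu.lintegral_weightMeasure]
  congr 1
  refine setLIntegral_congr_fun measurableSet_Ioi fun t (ht : 0 < t) => ?_
  simp only [kernel_weightMeasure w _ ht.le]

lemma lhs_congr {q r : ℝ} {u w h h' : ℝ → ℝ≥0∞}
    (hh : h =ᵐ[volume.restrict (Ioi (0 : ℝ))] h') : lhs q r u w h = lhs q r u w h' := by
  rw [lhs, lhs]
  congr 1
  refine setLIntegral_congr_fun measurableSet_Ioi fun t (ht : 0 < t) => ?_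
  congr 1
  refine iSup_congr fun s => iSup_congr fun (hs : t < s) => ?_
  rw [lintegral_congr_ae (ae_restrict_of_ae_restrict_of_subset
    (Ioi_subset_Ioi (ht.trans hs).le) hh)]

/-- The inequality for weights and the inequality for the associated measures agree. -/
lemma holdsWith_iff {q r : ℝ} (hr : 0 < r) {u v w v' : ℝ → ℝ≥0∞} (hu : IsWeight u)
    (hv' : v =ᵐ[volume.restrict (Ioi (0 : ℝ))] v') (C : ℝ≥0) :
    HoldsWith q r u v w C ↔
      MeasureHolds (weightMeasure u) (weightMeasure w) (r / q) r v' C := by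
  have hi : ∀ h h' : ℝ → ℝ≥0∞, h =ᵐ[volume.restrict (Ioi (0 : ℝ))] h' →
      ∫⁻ y in Ioi (0 : ℝ), h y * v y = ∫⁻ y in Ioi (0 : ℝ), h' y * v' y :=
    fun h h' hh => lintegral_congr_ae (hh.mul hv')
  constructor
  · intro H h hm
    have := H h hm.aemeasurable
    rwa [lhs_eq hu, one_div, ENNReal.rpow_inv_le_iff hr, hi h h (EventuallyEq.refl _ _)] at this
  · intro H h hm
    have := H (hm.mk h) hm.measurable_mk
    rw [← ENNReal.rpow_inv_le_iff hr, ← one_div, ← lhs_eq hu] at this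
    rwa [lhs_congr hm.ae_eq_mk, hi h _ hm.ae_eq_mk]

section constants

variable {q r : ℝ} {u v w v' : ℝ → ℝ≥0∞}

lemma ae_eq_Ici (hv' : v =ᵐ[volume.restrict (Ioi (0 : ℝ))] v') {t : ℝ} (ht : 0 < t) :
    v =ᵐ[volume.restrict (Ici t)] v' :=
  ae_restrict_of_ae_restrict_of_subset (Ici_subset_Ioi.2 ht) hv'

lemma D₁_eq (hq : 0 < q) (hr : 0 < r) (hu : IsWeight u)
    (hv' : v =ᵐ[volume.restrict (Ioi (0 : ℝ))] v') :
    D₁ q r u v w = ⨆ t ∈ Ioi (0 : ℝ),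
      mass (weightMeasure u) (weightMeasure w) (r / q) t ^ (1 / r) *
        tailSup (fun z => (v' z)⁻¹) t := by
  refine iSup_congr fun t => iSup_congr fun (ht : 0 < t) => ?_
  rw [mass_weightMeasure hu (div_pos hr hq)]
  congr 1
  exact essSup_congr_ae ((ae_eq_Ici hv' ht).mono fun z hz => by simp only [hz])

lemma D₂_eq (hr : 0 < r) (hv' : v =ᵐ[volume.restrict (Ioi (0 : ℝ))] v') :
    D₂ q r u v w = ⨆ t ∈ Ioi (0 : ℝ), weightMeasure u (Iic t) ^ (1 / r) *
      tailSup (fun z => kernel (weightMeasure w) (r / q) t z ^ (1 / r) * (v' z)⁻¹) t := by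
  refine iSup_congr fun t => iSup_congr fun (ht : 0 < t) => ?_
  rw [weightMeasure_Iic]
  congr 1
  refine essSup_congr_ae ((ae_eq_Ici hv' ht).mono fun z hz => ?_)
  simp only [hz]
  rw [kernel_weightMeasure w _ ht.le, ← ENNReal.rpow_mul]
  congr 2
  field_simp

lemma E₁_eq (hr1 : r < 1) (hu : IsWeight u)
    (hv' : v =ᵐ[volume.restrict (Ioi (0 : ℝ))] v') :
    E₁ q r u v w = (∫⁻ t, densityE₁ (weightMeasure u) (weightMeasure w) (r / q) (conj r) v' t
      ∂(weightMeasure u)) ^ (1 / conj r) := by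
  have h1r : 1 - r ≠ 0 := by linarith
  rw [E₁, hu.lintegral_weightMeasure]
  congr 1
  refine setLIntegral_congr_fun measurableSet_Ioi fun t (ht : 0 < t) => ?_
  simp only [densityE₁, weightMeasure_Iic]
  rw [mul_comm (_ ^ conj r) (u t), mul_assoc]
  congr 2
  refine essSup_congr_ae ((ae_eq_Ici hv' ht).mono fun z hz => ?_)
  simp only [hz]
  rw [kernel_weightMeasure w _ ht.le, ← ENNReal.rpow_mul,
    show r / q * (1 + conj r) = conj r / q by rw [conj]; field_simp; ring]

lemma E₂_eq (hq : 0 < q) (hr : 0 < r) (hu : IsWeight u)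
    (hv' : v =ᵐ[volume.restrict (Ioi (0 : ℝ))] v') :
    E₂ q r u v w = (∫⁻ t, densityE₂ (weightMeasure u) (weightMeasure w) (r / q) (conj r) v' t
      ∂(weightMeasure u)) ^ (1 / conj r) := by
  rw [E₂, hu.lintegral_weightMeasure]
  congr 1
  refine setLIntegral_congr_fun measurableSet_Ioi fun t (ht : 0 < t) => ?_
  simp only [densityE₂]
  rw [mass_weightMeasure hu (div_pos hr hq), mul_comm (_ ^ conj r) (u t), mul_assoc]
  congr 2
  refine essSup_congr_ae ((ae_eq_Ici hv' ht).mono fun z hz => ?_)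
  simp only [hz]
  rw [kernel_weightMeasure w _ ht.le]

/-- Two-sided bounds for admissible constants give the characterization and the equivalence with
the best constant. -/
lemma equivalence_of_bounds {X Y : ℝ≥0∞} {c : ℝ≥0} (hc : 0 < c)
    (hup : X ≠ ∞ → Y ≠ ∞ → ∃ C : ℝ≥0, HoldsWith q r u v w C ∧ (C : ℝ≥0∞) ≤ c * (X + Y))
    (hlow : ∀ C : ℝ≥0, HoldsWith q r u v w C → X + Y ≤ c * C) :
    (Holds q r u v w ↔ X < ∞ ∧ Y < ∞) ∧ bestConst q r u v w ≤ c * (X + Y) ∧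
      X + Y ≤ c * bestConst q r u v w := by
  have hc0 : (c : ℝ≥0∞) ≠ 0 := by exact_mod_cast hc.ne'
  refine ⟨⟨?_, ?_⟩, ?_, ?_⟩
  · rintro ⟨C, hC⟩
    exact ENNReal.add_lt_top.1 ((hlow C hC).trans_lt (ENNReal.mul_lt_top (by simp) (by simp)))
  · rintro ⟨hX, hY⟩
    obtain ⟨C, hC, -⟩ := hup hX.ne hY.ne
    exact ⟨C, hC⟩
  · by_cases h : X + Y = ∞
    · rw [h, ENNReal.mul_top hc0]
      exact le_top
    · obtain ⟨hX, hY⟩ := ENNReal.add_ne_top.1 h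
      obtain ⟨C, hC, hle⟩ := hup hX hY
      exact (iInf₂_le C hC).trans hle
  · rw [mul_comm, ← ENNReal.div_le_iff hc0 (by simp)]
    refine le_iInf₂ fun C hC => ?_
    rw [ENNReal.div_le_iff hc0 (by simp), mul_comm]
    exact hlow C hC

end constants

lemma lowerConst_ne_top {p a : ℝ} (ha : 0 ≤ a) : lowerConst p a ≠ ∞ := by
  have h2 : ∀ b : ℝ, (2 : ℝ≥0∞) ^ b ≠ ∞ := fun b => by simp
  unfold lowerConst
  have h1a : 0 ≤ 1 + a := by linarith
  have e1 : (2 * (2 : ℝ≥0∞) ^ p + 2) ^ a ≠ ∞ := ENNReal.rpow_ne_top_of_nonneg ha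
    (ENNReal.add_ne_top.2 ⟨ENNReal.mul_ne_top (by simp) (h2 p), by simp⟩)
  have e2 : (1 + (2 : ℝ≥0∞) ^ p) ^ a ≠ ∞ := ENNReal.rpow_ne_top_of_nonneg ha
    (ENNReal.add_ne_top.2 ⟨by simp, h2 p⟩)
  have e3 : ((2 : ℝ≥0∞) ^ (p + 1)) ^ (1 + a) ≠ ∞ := ENNReal.rpow_ne_top_of_nonneg h1a (h2 _)
  have e4 : (2 * ((2 : ℝ≥0∞) ^ (p + 1) + 4)) ^ (1 + a) ≠ ∞ := ENNReal.rpow_ne_top_of_nonneg h1a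
    (ENNReal.mul_ne_top (by simp) (ENNReal.add_ne_top.2 ⟨h2 _, by simp⟩))
  refine ENNReal.mul_ne_top (ENNReal.mul_ne_top (by simp) (ENNReal.add_ne_top.2
    ⟨ENNReal.mul_ne_top (by simp) e1, ENNReal.mul_ne_top (ENNReal.mul_ne_top (by simp)
      (ENNReal.mul_ne_top (h2 p) e2)) (ENNReal.add_ne_top.2 ⟨by simp, e3⟩)⟩)) e4

lemma upperConst_ne_top {p a : ℝ} (ha : 0 ≤ a) : upperConst p a ≠ ∞ := by
  have h2 : ∀ b : ℝ, (2 : ℝ≥0∞) ^ b ≠ ∞ := fun b => by simp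
  have h22 : 2 * (2 : ℝ≥0∞) ^ p ≠ ∞ := ENNReal.mul_ne_top (by simp) (h2 p)
  refine ENNReal.mul_ne_top (ENNReal.rpow_ne_top_of_nonneg (by positivity) ?_) (h2 _)
  exact ENNReal.mul_ne_top (ENNReal.mul_ne_top (ENNReal.mul_ne_top (by simp)
    (ENNReal.rpow_ne_top_of_nonneg ha h22)) (ENNReal.add_ne_top.2 ⟨by simp, h22⟩)) (h2 a)

end SupHardy

theorem corollary4 (q r : ℝ) (hq : 0 < q) (hr : 0 < r) :
    (1 ≤ r → ∃ c : ℝ≥0, 0 < c ∧ ∀ u v w : ℝ → ℝ≥0∞,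
      SupHardy.IsWeight u → SupHardy.IsWeight v → SupHardy.IsWeight w →
        (SupHardy.Holds q r u v w ↔
          SupHardy.D₁ q r u v w < ∞ ∧ SupHardy.D₂ q r u v w < ∞) ∧
        SupHardy.bestConst q r u v w
          ≤ c * (SupHardy.D₁ q r u v w + SupHardy.D₂ q r u v w) ∧
        SupHardy.D₁ q r u v w + SupHardy.D₂ q r u v w
          ≤ c * SupHardy.bestConst q r u v w) ∧
    (r < 1 → ∃ c : ℝ≥0, 0 < c ∧ ∀ u v w : ℝ → ℝ≥0∞,
      SupHardy.IsWeight u → SupHardy.IsWeight v → SupHardy.IsWeight w →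
        (SupHardy.Holds q r u v w ↔
          SupHardy.E₁ q r u v w < ∞ ∧ SupHardy.E₂ q r u v w < ∞) ∧
        SupHardy.bestConst q r u v w
          ≤ c * (SupHardy.E₁ q r u v w + SupHardy.E₂ q r u v w) ∧
        SupHardy.E₁ q r u v w + SupHardy.E₂ q r u v w
          ≤ c * SupHardy.bestConst q r u v w) := by
  have hp : 0 < r / q := div_pos hr hq
  -- a measurable representative of `v` which is finite almost everywhere
  have hrep : ∀ v : ℝ → ℝ≥0∞, SupHardy.IsWeight v → ∃ v' : ℝ → ℝ≥0∞, Measurable v' ∧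
      v =ᵐ[volume.restrict (Ioi (0 : ℝ))] v' ∧ ∀ᵐ y, 0 < y → v' y ≠ ∞ := by
    intro v hv
    refine ⟨hv.memMPlus.mk v, hv.memMPlus.measurable_mk, hv.memMPlus.ae_eq_mk, ?_⟩
    have h : ∀ᵐ y ∂(volume.restrict (Ioi (0 : ℝ))), hv.memMPlus.mk v y ≠ ∞ := by
      filter_upwards [hv.ae_lt_top, hv.memMPlus.ae_eq_mk] with y h1 h2
      rw [← h2]
      exact h1.ne
    exact (ae_restrict_iff' measurableSet_Ioi).1 h
  constructor
  · intro hr1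
    refine ⟨2, by norm_num, fun u v w hu hv hw => ?_⟩
    obtain ⟨v', hv'm, hv', hvt⟩ := hrep v hv
    refine SupHardy.equivalence_of_bounds (by norm_num) ?_ ?_
    · intro hD₁ _
      refine ⟨(SupHardy.D₁ q r u v w).toNNReal, ?_, ?_⟩
      · rw [SupHardy.holdsWith_iff hr hu hv', ENNReal.coe_toNNReal hD₁]
        refine SupHardy.measureHolds_of_one_le hr1 hu.isWeightMeasure hw.isWeightMeasure hp hv'm
          hvt hD₁ fun t ht => ?_
        rw [SupHardy.D₁_eq hq hr hu hv']
        exact le_iSup₂_of_le t ht le_rfl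
      · rw [ENNReal.coe_toNNReal hD₁]
        calc SupHardy.D₁ q r u v w ≤ 1 * (SupHardy.D₁ q r u v w + SupHardy.D₂ q r u v w) := by
              rw [one_mul]; exact le_self_add
          _ ≤ _ := by gcongr; norm_num
    · intro C hC
      rw [SupHardy.holdsWith_iff hr hu hv'] at hC
      rw [SupHardy.D₁_eq hq hr hu hv', SupHardy.D₂_eq hr hv', ENNReal.coe_ofNat, two_mul]
      exact add_le_add
        (iSup₂_le fun t ht => hC.mass_rpow_mul_tailSup_le hr hu.isWeightMeasure
          hw.isWeightMeasure hp hv'm ht)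
        (iSup₂_le fun t ht => hC.measure_rpow_mul_tailSup_le hr hu.isWeightMeasure
          hw.isWeightMeasure hp hv'm ht)
  · intro hr1
    have ha : 0 < SupHardy.conj r := div_pos hr (by linarith)
    have ha1 : 0 < 1 / SupHardy.conj r := by positivity
    set K₁ := SupHardy.upperConst (r / q) (SupHardy.conj r)
    set K₂ := 2 * SupHardy.lowerConst (r / q) (SupHardy.conj r) ^ (1 / SupHardy.conj r)
    have hK₁ : K₁ ≠ ∞ := SupHardy.upperConst_ne_top ha.le
    have hK₂ : K₂ ≠ ∞ := ENNReal.mul_ne_top (by simp) (ENNReal.rpow_ne_top_of_nonneg ha1.le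
      (SupHardy.lowerConst_ne_top ha.le))
    have hK : ((K₁ + K₂).toNNReal + 1 : ℝ≥0) = K₁ + K₂ + 1 := by
      rw [ENNReal.coe_add, ENNReal.coe_toNNReal (ENNReal.add_ne_top.2 ⟨hK₁, hK₂⟩), ENNReal.coe_one]
    refine ⟨(K₁ + K₂).toNNReal + 1, by positivity, fun u v w hu hv hw => ?_⟩
    obtain ⟨v', hv'm, hv', hvt⟩ := hrep v hv
    refine SupHardy.equivalence_of_bounds (by positivity) ?_ ?_
    · rw [SupHardy.E₁_eq hr1 hu hv', SupHardy.E₂_eq hq hr hu hv', hK]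
      intro h1 h2
      have h1' := mt (fun h => ENNReal.rpow_eq_top_iff_of_pos ha1 |>.2 h) h1
      have h2' := mt (fun h => ENNReal.rpow_eq_top_iff_of_pos ha1 |>.2 h) h2
      obtain ⟨M, hMt, hM, hle⟩ := SupHardy.exists_measureHolds hr hr1 rfl hu.isWeightMeasure
        hw.isWeightMeasure hp hv'm hvt h1' h2'
      refine ⟨M.toNNReal, ?_, ?_⟩
      · rw [SupHardy.holdsWith_iff hr hu hv', ENNReal.coe_toNNReal hMt]
        exact hM
      · rw [ENNReal.coe_toNNReal hMt]
        refine hle.trans (mul_le_mul' ?_ le_rfl)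
        rw [add_assoc]
        exact le_self_add
    · intro C hC
      rw [SupHardy.holdsWith_iff hr hu hv'] at hC
      rw [SupHardy.E₁_eq hr1 hu hv', SupHardy.E₂_eq hq hr hu hv', hK]
      refine (hC.add_le hr hr1 rfl hu.isWeightMeasure hw.isWeightMeasure hp hv'm).trans ?_
      refine mul_le_mul' ?_ le_rfl
      rw [add_right_comm]
      exact le_add_self
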